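/- Let $V=V_0\oplus V_1$ be a $\mathbb Z_2$-graded complex vector space (bosonic and fermionic operators; $|A|$ denotes the parity of a homogeneous $A$) with an even linear map $\partial:V\to V$ and even bilinear operations $[AB]_n$, $n\in\mathbb Z$, with $[AB]_n=0$ for $n$ large (depending on $A,B$), encoding operator product expansions (OPEs) $$A(z)B(w)=\sum_{n}\frac{[AB]_n(w)}{(z-w)^n}.$$ Suppose that they satisfy the consistency conditions, for all $n,p,q\in\mathbb Z$ ($A,B$ being homogeneous in the last two): $$[\partial A\,B]_{n+1}=-n[AB]_n,\qquad [A\,\partial B]_{n+1}=n[AB]_n+\partial[AB]_{n+1},$$ $$[BA]_q=(-1)^{|A||B|}\sum_{l\ge q}\frac{(-1)^l}{(l-q)!}\,\partial^{\,l-q}[AB]_l,$$ $$[A[BC]_p]_q=(-1)^{|A||B|}[B[AC]_q]_p+\sum_{l>0}\binom{q-1}{l-1}[[AB]_lC]_{p+q-l}.$$ Let $\langle A_1(z_1)\cdots A_n(z_n)\rangle$ ($n\ge 0$, $A_i\in V$, $z_1,\dots,z_n\in\mathbb C$ pairwise distinct) be correlation functions which are linear in each $A_i$, holomorphic in $(z_1,\dots,z_n)$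 away from coinciding points, satisfy $\langle X\,\partial A(z)\,Y\rangle=\frac{d}{dz}\langle X\,A(z)\,Y\rangle$, and are computed by substituting two operators with their complete OPE: $$\langle X\,A(z)B(w)\,Y\rangle=\sum_{n\in\mathbb Z}(z-w)^{-n}\,\langle X\,[AB]_n(w)\,Y\rangle$$ (a convergent sum) for all $A,B\in V$ and all sequences $X,Y$ of operators at points whose distances to $w$ all exceed $|z-w|$. Let $T_0,T_1,\dots,T_n\in V$ be homogeneous, let $z_1,\dots,z_n\in\mathbb C$ be pairwise distinct, and let $\varepsilon$ be holomorphic on an open set $U\subseteq\mathbb C$. Let $C,C_1,\dots,C_n$ be piecewise $C^1$ closed curves in $U$ which avoid all the points $z_j$ and have winding number $0$ around every point outside $U$. Suppose that $C$ has winding number $1$ around each of $z_1,\dots,z_n$, and that $C_i$ has winding number $1$ around $z_i$ and $0$ around $z_j$ for $j\neq i$. Then the Ward identity holds: $$\oint_C\frac{dz}{2\pi i}\,\varepsilon(z)\,\langle T_0(z)T_1(z_1)\cdots T_n(z_n)\rangle=\sum_{i=1}^n\oint_{C_i}\frac{dz}{2\pi i}\,\varepsilon(z)\,(-1)^{|T_0|(|T_1|+\cdots+|T_{i-1}|)}\sum_{m>0}\frac{\langle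 T_1(z_1)\cdots [T_0T_i]_m(z_i)\cdots T_n(z_n)\rangle}{(z-z_i)^m},$$ where in the $i$-th summand $[T_0T_i]_m(z_i)$ replaces $T_i(z_i)$ (the contraction of $T_0(z)$ with $T_i(z_i)$). -/

import Mathlib

noncomputable section

/-- The sign `(-1)^{|A||B|}` for operators of parities `a`, `b` (`0` bosonic, `1` fermionic). -/
def parSign (a b : ZMod 2) : ℂ := (-1) ^ (a.val * b.val)

/-- A space of operators with operator product expansions
`A(z) B(w) = ∑_{n ≤ h(A,B)} [AB]_n(w) (z - w)^{-n}`: a `ℤ/2`-graded complex vector space with an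
even linear map `∂` and even bilinear operations `[AB]_n`, `n ∈ ℤ`, vanishing for large `n`, which
satisfy the consistency conditions on OPEs. `bracket n A B` is `[AB]_n`. -/
structure OPEAlgebra (V : Type*) [AddCommGroup V] [Module ℂ V] where
  parity : ZMod 2 → Submodule ℂ V
  isInternal : DirectSum.IsInternal parity
  deriv : V →ₗ[ℂ] V
  deriv_mem : ∀ (a : ZMod 2), ∀ A ∈ parity a, deriv A ∈ parity a
  bracket : ℤ → V →ₗ[ℂ] V →ₗ[ℂ] V
  bracket_mem : ∀ (a b : ZMod 2) (n : ℤ), ∀ A ∈ parity a, ∀ B ∈ parity b,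
    bracket n A B ∈ parity (a + b)
  bracket_eq_zero_of_large : ∀ A B : V, ∃ h : ℤ, ∀ n : ℤ, h < n → bracket n A B = 0
  /-- `[∂A B]_{n+1} = -n [AB]_n`. -/
  deriv_left : ∀ (A B : V) (n : ℤ), bracket (n + 1) (deriv A) B = -(n : ℂ) • bracket n A B
  /-- `[A ∂B]_{n+1} = n [AB]_n + ∂[AB]_{n+1}`. -/
  deriv_right : ∀ (A B : V) (n : ℤ),
    bracket (n + 1) A (deriv B) = (n : ℂ) • bracket n A B + deriv (bracket (n + 1) A B)
  /-- Commutation: `[BA]_q = (-1)^{|A||B|} ∑_{l ≥ q} (-1)^l / (l - q)! ∂^{l-q} [AB]_l`;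
  the summation index `k` below is `l - q`, and the sum has finitely many non-zero terms. -/
  comm : ∀ (a b : ZMod 2), ∀ A ∈ parity a, ∀ B ∈ parity b, ∀ q : ℤ,
    bracket q B A = parSign a b •
      ∑ᶠ k : ℕ, ((-1 : ℂ) ^ (q + (k : ℤ)) / (k.factorial : ℂ)) •
        (deriv ^ k) (bracket (q + (k : ℤ)) A B)
  /-- Associativity:
  `[A[BC]_p]_q = (-1)^{|A||B|} [B[AC]_q]_p + ∑_{l > 0} binom(q-1, l-1) [[AB]_l C]_{p+q-l}`;
  the summation index `k` below is `l - 1`, and the sum has finitely many non-zero terms. -/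
  assoc : ∀ (a b : ZMod 2), ∀ A ∈ parity a, ∀ B ∈ parity b, ∀ (C : V) (p q : ℤ),
    bracket q A (bracket p B C) = parSign a b • bracket p B (bracket q A C) +
      ∑ᶠ k : ℕ, ((Ring.choose (q - 1) k : ℤ) : ℂ) •
        bracket (p + q - ((k : ℤ) + 1)) (bracket ((k : ℤ) + 1) A B) C

/-- The insertion points of a sequence of operators are pairwise distinct. -/
def DistinctPoints {V : Type*} (L : List (V × ℂ)) : Prop := (L.map Prod.snd).Nodup

/-- The sequence `T_1(z_1), …, T_n(z_n)`. -/
def insertions {V : Type*} {n : ℕ} (T : Fin n → V) (z : Fin n → ℂ) : List (V × ℂ) :=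
  List.ofFn fun i => (T i, z i)

/-- `corr` is a system of correlation functions, computed by substituting two operators with their
complete OPE. The value `corr [(A₁, z₁), …, (Aₙ, zₙ)]` is `⟨A₁(z₁) ⋯ Aₙ(zₙ)⟩`; only its values at
pairwise distinct points matter. -/
structure OPEAlgebra.IsCorrelator {V : Type*} [AddCommGroup V] [Module ℂ V] (𝒜 : OPEAlgebra V)
    (corr : List (V × ℂ) → ℂ) : Prop where
  /-- Correlation functions are linear in every operator. -/
  map_add : ∀ (X Y : List (V × ℂ)) (A B : V) (z : ℂ), DistinctPoints (X ++ (A, z) :: Y) →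
    corr (X ++ (A + B, z) :: Y) = corr (X ++ (A, z) :: Y) + corr (X ++ (B, z) :: Y)
  map_smul : ∀ (X Y : List (V × ℂ)) (c : ℂ) (A : V) (z : ℂ), DistinctPoints (X ++ (A, z) :: Y) →
    corr (X ++ (c • A, z) :: Y) = c * corr (X ++ (A, z) :: Y)
  /-- Correlation functions are holomorphic away from coinciding points. -/
  holomorphic : ∀ (n : ℕ) (T : Fin n → V),
    DifferentiableOn ℂ (fun z : Fin n → ℂ => corr (insertions T z)) {z | Function.Injective z}
  /-- `∂` corresponds to the derivative: `⟨X ∂A(z) Y⟩ = d/dz ⟨X A(z) Y⟩`. -/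
  hasDerivAt : ∀ (X Y : List (V × ℂ)) (A : V) (z : ℂ), DistinctPoints (X ++ (A, z) :: Y) →
    HasDerivAt (fun u : ℂ => corr (X ++ (A, u) :: Y)) (corr (X ++ (𝒜.deriv A, z) :: Y)) z
  /-- `⟨X A(z) B(w) Y⟩ = ∑_n (z - w)^{-n} ⟨X [AB]_n(w) Y⟩` if `z` is closer to `w` than all the
  other insertion points are. -/
  ope : ∀ (X Y : List (V × ℂ)) (A B : V) (z w : ℂ),
    DistinctPoints (X ++ (A, z) :: (B, w) :: Y) → (∀ P ∈ X ++ Y, ‖z - w‖ < ‖P.2 - w‖) →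
    HasSum (fun m : ℤ => (z - w) ^ (-m) * corr (X ++ (𝒜.bracket m A B, w) :: Y))
      (corr (X ++ (A, z) :: (B, w) :: Y))

/-- The correlation function `⟨T_1(z_1) ⋯ T_n(z_n)⟩` with `T_0(z)` contracted with `T_i(z_i)`: the
sign of moving `T_0` past `T_1, …, T_{i-1}`, times the correlation function in which the singular
part `∑_{m > 0} [T_0 T_i]_m(z_i) (z - z_i)^{-m}` of the OPE is substituted for `T_i(z_i)`. Here `p₀`
and `p` are the parities of `T_0` and of the `T_j`; the summation index `k` is `m - 1`, and the sum
has finitely many non-zero terms. -/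
def OPEAlgebra.contraction {V : Type*} [AddCommGroup V] [Module ℂ V] (𝒜 : OPEAlgebra V)
    (corr : List (V × ℂ) → ℂ) {n : ℕ} (p₀ : ZMod 2) (p : Fin n → ZMod 2) (T₀ : V) (T : Fin n → V)
    (z : Fin n → ℂ) (i : Fin n) (u : ℂ) : ℂ :=
  (∏ j ∈ Finset.univ.filter (fun j : Fin n => j < i), parSign p₀ (p j)) *
    ∑ᶠ k : ℕ, (u - z i) ^ (-((k : ℤ) + 1)) *
      corr (insertions (Function.update T i (𝒜.bracket ((k : ℤ) + 1) T₀ (T i))) z)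

/-- `γ`, restricted to `[0, 1]`, is a piecewise `C¹` closed curve (which includes its continuity,
since `γ` is `C¹` on each closed subinterval `[s k, s (k+1)]`). -/
def IsPiecewiseC1Loop (γ : ℝ → ℂ) : Prop :=
  γ 0 = γ 1 ∧ ∃ (N : ℕ) (s : ℕ → ℝ), Monotone s ∧ s 0 = 0 ∧ s N = 1 ∧
    ∀ k < N, ContDiffOn ℝ 1 γ (Set.Icc (s k) (s (k + 1)))

/-- `∮_γ dz/(2πi) f(z)`. -/
def contourIntegral (γ : ℝ → ℂ) (f : ℂ → ℂ) : ℂ :=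
  (2 * (Real.pi : ℂ) * Complex.I)⁻¹ * ∫ t in (0 : ℝ)..1, f (γ t) * deriv γ t

/-- The winding number of `γ` around a point `a` not on `γ`. -/
def windingNumber (γ : ℝ → ℂ) (a : ℂ) : ℂ := contourIntegral γ (fun z => (z - a)⁻¹)

/-- `γ` is a closed contour which encircles once, anticlockwise, the points of `S`, and none of the
other points of `P`; it meets no point of `P`, and `γ` and all points around which it winds lie
in `U`. -/
structure EncirclesOnce (U P S : Set ℂ) (γ : ℝ → ℂ) : Prop where
  isLoop : IsPiecewiseC1Loop γ
  mapsTo : ∀ t ∈ Set.Icc (0 : ℝ) 1, γ t ∈ U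
  avoids : ∀ t ∈ Set.Icc (0 : ℝ) 1, γ t ∉ P
  winding_outside : ∀ a ∉ U, windingNumber γ a = 0
  winding_inside : ∀ a ∈ S, windingNumber γ a = 1
  winding_others : ∀ a ∈ P \ S, windingNumber γ a = 0

end

/-!
The correlation function `f(u) = ⟨T₀(u) T₁(z₁) ⋯ Tₙ(zₙ)⟩` is holomorphic in `u` away from the
points `zᵢ`, and its principal part at `zᵢ` is the contraction `cᵢ` of `T₀` with `Tᵢ`. So
`f - ∑ cᵢ` extends to an entire function `F`, and `∮_C ε F = 0` by Cauchy's theorem. The remaining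
integrals `∮_C ε cᵢ` agree with those over the loops around `zᵢ` because each is determined by
the winding number around `zᵢ`, the only singularity of `cᵢ`.

*Principal parts.* To apply the OPE of `T₀(u) Tᵢ(zᵢ)` when `u` is close to `zᵢ`, the operator
`T₀` has to be moved past `T₁, …, Tᵢ₋₁`. That operators commute up to a sign in correlation
functions is not assumed but follows from the commutation rule for the brackets: the Laurent
series `∑_m (z - w)^{-m} ⟨X [AB]_m(w) Y⟩` is re-expanded about `w = z` by the Taylor series of
its coefficients. Joint continuity of the correlation functions bounds the coefficients
uniformly in `w` by Cauchy's estimate, so that the double series converges absolutely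
(`hasSum_reexpand`), and the result is, up to sign, the OPE of `B(w) A(z)`. This gives the
exchange of `A` and `B` for `w` close to `z`, and analytic continuation in `w` gives it
everywhere (`OPEAlgebra.IsCorrelator.swap`). The principal parts are read off in
`OPEAlgebra.IsCorrelator.exists_contraction_eq`.

*Contour integrals.* Cauchy's theorem for loops that have winding number `0` around all points
outside of `U` (`contourIntegral_eq_zero_of_differentiableOn`) is proved by Dixon's argument.
Dividing off one pole at a time, it follows that the integral of `g(w) / (w - a)^m`, with `g`
holomorphic on `U`, is a multiple of the winding number around `a`, by a factor independent of
the loop (`exists_contourIntegral_mul_inv_pow`).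
-/

open Set Filter Topology MeasureTheory

/-! ### Contour integrals over piecewise `C¹` loops -/

namespace IsPiecewiseC1Loop

variable {γ : ℝ → ℂ}

theorem continuousOn (hγ : IsPiecewiseC1Loop γ) : ContinuousOn γ (Icc 0 1) := by
  obtain ⟨-, N, s, hs, h0, h1, hd⟩ := hγ
  have key : ∀ k ≤ N, ContinuousOn γ (Icc (s 0) (s k)) := by
    intro k
    induction k with
    | zero => intro _; simp
    | succ k ih =>
      intro hk
      rw [← Icc_union_Icc_eq_Icc (hs (Nat.zero_le k)) (hs (Nat.le_succ k))]
      exact (ih (by omega)).union_of_isClosed (hd k (by omega)).continuousOn isClosed_Icc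
        isClosed_Icc
  simpa [h0, h1] using key N le_rfl

theorem isCompact_image (hγ : IsPiecewiseC1Loop γ) : IsCompact (γ '' Icc 0 1) :=
  isCompact_Icc.image_of_continuousOn hγ.continuousOn

theorem intervalIntegrable_deriv (hγ : IsPiecewiseC1Loop γ) :
    IntervalIntegrable (deriv γ) volume 0 1 := by
  obtain ⟨-, N, s, hs, h0, h1, hd⟩ := hγ
  rw [← h0, ← h1]
  refine IntervalIntegrable.trans_iterate fun k hk => ?_
  rcases (hs (Nat.le_succ k)).eq_or_lt with h | h
  · simp only [Nat.succ_eq_add_one] at h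
    simp [h]
  · have hc : ContinuousOn (derivWithin γ (Icc (s k) (s (k + 1)))) (Icc (s k) (s (k + 1))) :=
      (hd k hk).continuousOn_derivWithin (uniqueDiffOn_Icc h) le_rfl
    have hi := hc.intervalIntegrable_of_Icc (μ := volume) h.le
    refine hi.congr_ae ?_
    rw [uIoc_of_le h.le, ← restrict_Ioo_eq_restrict_Ioc]
    refine (ae_restrict_iff' measurableSet_Ioo).2 (Eventually.of_forall fun t ht => ?_)
    exact derivWithin_of_mem_nhds (Icc_mem_nhds ht.1 ht.2)

theorem exists_countable_hasDerivAt (hγ : IsPiecewiseC1Loop γ) :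
    ∃ S : Set ℝ, S.Countable ∧ ∀ t ∈ Ioo (0 : ℝ) 1 \ S, HasDerivAt γ (deriv γ t) t := by
  obtain ⟨-, N, s, hs, h0, h1, hd⟩ := hγ
  refine ⟨range s, countable_range s, fun t ht => ?_⟩
  have key : ∀ k ≤ N, t < s k → ∃ j < k, s j < t ∧ t < s (j + 1) := by
    intro k
    induction k with
    | zero => intro _ h; exact absurd (h0 ▸ h) (not_lt.2 ht.1.1.le)
    | succ k ih =>
      intro hk h
      rcases lt_trichotomy t (s k) with h' | h' | h'
      · obtain ⟨j, hj, hj'⟩ := ih (by omega) h'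
        exact ⟨j, by omega, hj'⟩
      · exact absurd ⟨k, h'.symm⟩ ht.2
      · exact ⟨k, by omega, h', h⟩
  obtain ⟨j, hj, hj1, hj2⟩ := key N le_rfl (h1 ▸ ht.1.2)
  exact (((hd j hj).differentiableOn one_ne_zero).differentiableAt
    (Icc_mem_nhds hj1 hj2)).hasDerivAt

theorem intervalIntegrable_mul_deriv (hγ : IsPiecewiseC1Loop γ) {f : ℂ → ℂ}
    (hf : ContinuousOn f (γ '' Icc 0 1)) :
    IntervalIntegrable (fun t => f (γ t) * deriv γ t) volume 0 1 := by
  have := hf.comp hγ.continuousOn (mapsTo_image _ _)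
  refine hγ.intervalIntegrable_deriv.continuousOn_mul ?_
  rwa [uIcc_of_le zero_le_one]

end IsPiecewiseC1Loop

theorem continuousOn_inv_sub {γ : ℝ → ℂ} {a : ℂ} (ha : a ∉ γ '' Icc 0 1) :
    ContinuousOn (fun w => (w - a)⁻¹) (γ '' Icc 0 1) :=
  ((continuous_id.sub continuous_const).continuousOn (f := fun w : ℂ => w - a)).inv₀
    fun w hw h => ha (by rwa [← sub_eq_zero.1 h])

theorem continuousOn_div_sub {γ : ℝ → ℂ} {U : Set ℂ} (hγU : γ '' Icc 0 1 ⊆ U) {f : ℂ → ℂ}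
    (hf : DifferentiableOn ℂ f U) {z : ℂ} (hz : z ∉ γ '' Icc 0 1) :
    ContinuousOn (fun w => f w * (w - z)⁻¹) (γ '' Icc 0 1) :=
  (hf.continuousOn.mono hγU).mul (continuousOn_inv_sub hz)

theorem contourIntegral_congr {γ : ℝ → ℂ} {f g : ℂ → ℂ} (h : EqOn f g (γ '' Icc 0 1)) :
    contourIntegral γ f = contourIntegral γ g := by
  unfold contourIntegral
  congr 1
  refine intervalIntegral.integral_congr fun t ht => ?_
  rw [uIcc_of_le zero_le_one] at ht
  simp only [h (mem_image_of_mem γ ht)]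

theorem contourIntegral_const_mul (γ : ℝ → ℂ) (c : ℂ) (f : ℂ → ℂ) :
    contourIntegral γ (fun w => c * f w) = c * contourIntegral γ f := by
  simp only [contourIntegral, mul_assoc, intervalIntegral.integral_const_mul]
  ring

section

variable {γ : ℝ → ℂ} (hγ : IsPiecewiseC1Loop γ)
include hγ

theorem contourIntegral_add {f g : ℂ → ℂ} (hf : ContinuousOn f (γ '' Icc 0 1))
    (hg : ContinuousOn g (γ '' Icc 0 1)) :
    contourIntegral γ (fun w => f w + g w) = contourIntegral γ f + contourIntegral γ g := by
  simp only [contourIntegral, add_mul]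
  rw [intervalIntegral.integral_add (hγ.intervalIntegrable_mul_deriv hf)
    (hγ.intervalIntegrable_mul_deriv hg), mul_add]

theorem contourIntegral_sum {ι : Type*} (s : Finset ι) {f : ι → ℂ → ℂ}
    (hf : ∀ i ∈ s, ContinuousOn (f i) (γ '' Icc 0 1)) :
    contourIntegral γ (fun w => ∑ i ∈ s, f i w) = ∑ i ∈ s, contourIntegral γ (f i) := by
  simp only [contourIntegral, Finset.sum_mul]
  rw [intervalIntegral.integral_finsetSum fun i hi =>
    hγ.intervalIntegrable_mul_deriv (hf i hi), Finset.mul_sum]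

/-- The integral over a loop of a function with a primitive near the loop vanishes. -/
theorem contourIntegral_eq_zero_of_hasDerivAt {F f : ℂ → ℂ}
    (hF : ∀ w ∈ γ '' Icc 0 1, HasDerivAt F (f w) w) (hf : ContinuousOn f (γ '' Icc 0 1)) :
    contourIntegral γ f = 0 := by
  obtain ⟨S, hS, hd⟩ := hγ.exists_countable_hasDerivAt
  have h := integral_eq_of_hasDerivAt_off_countable (fun t => F (γ t))
    (fun t => f (γ t) * deriv γ t) (a := 0) (b := 1) hS ?_ ?_
    (hγ.intervalIntegrable_mul_deriv hf)
  · rw [contourIntegral, h]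
    simp [hγ.1]
  · rw [uIcc_of_le zero_le_one]
    exact ContinuousOn.comp (fun w hw => (hF w hw).continuousAt.continuousWithinAt)
      hγ.continuousOn (mapsTo_image _ _)
  · rw [min_eq_left zero_le_one, max_eq_right zero_le_one]
    exact fun t ht => (hF _ (mem_image_of_mem γ (Ioo_subset_Icc_self ht.1))).comp t (hd t ht)

/-- Winding numbers are locally constant: on the loop, `(w - a)⁻¹ - (w - b)⁻¹` is the derivative of
`log ((w - a) / (w - b))` if `a` is closer to `b` than the loop is. -/
theorem windingNumber_eq_of_norm_lt {a b : ℂ} (hb : b ∉ γ '' Icc 0 1)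
    (h : ∀ w ∈ γ '' Icc 0 1, ‖a - b‖ < ‖w - b‖) : windingNumber γ a = windingNumber γ b := by
  have ha : a ∉ γ '' Icc 0 1 := fun ha => lt_irrefl _ (h a ha)
  have hcb : ContinuousOn (fun w => (-1) * (w - b)⁻¹) (γ '' Icc 0 1) :=
    continuousOn_const.mul (continuousOn_inv_sub hb)
  have hz := contourIntegral_eq_zero_of_hasDerivAt hγ
    (F := fun w => Complex.log ((w - a) * (w - b)⁻¹))
    (f := fun w => (w - a)⁻¹ + (-1) * (w - b)⁻¹) ?_
    ((continuousOn_inv_sub ha).add hcb)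
  · rw [contourIntegral_add hγ (continuousOn_inv_sub ha) hcb, contourIntegral_const_mul] at hz
    unfold windingNumber
    linear_combination hz
  · intro w hw
    have h1 : w - a ≠ 0 := fun h => ha (by rwa [← sub_eq_zero.1 h])
    have h2 : w - b ≠ 0 := fun h => hb (by rwa [← sub_eq_zero.1 h])
    have hs : (w - a) * (w - b)⁻¹ ∈ Complex.slitPlane := by
      have : (w - a) * (w - b)⁻¹ = 1 + (b - a) / (w - b) := by field_simp; ring
      rw [this]
      refine Complex.mem_slitPlane_of_norm_lt_one ?_
      rw [norm_div, norm_sub_rev b a, div_lt_one (norm_pos_iff.2 h2)]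
      exact h w hw
    have hd1 : HasDerivAt (fun w => (w - a) * (w - b)⁻¹)
        (1 * (w - b)⁻¹ + (w - a) * (-1 / (w - b) ^ 2)) w :=
      ((hasDerivAt_id w).sub_const a).mul (((hasDerivAt_id w).sub_const b).inv h2)
    convert hd1.clog hs using 1
    field_simp

/-- The winding number vanishes far away: on the loop, `(w - a)⁻¹` is the derivative of
`log (1 - w / a)`. -/
theorem windingNumber_eq_zero_of_norm_lt {a : ℂ} (h : ∀ w ∈ γ '' Icc 0 1, ‖w‖ < ‖a‖) :
    windingNumber γ a = 0 := by
  have ha : a ∉ γ '' Icc 0 1 := fun ha => lt_irrefl _ (h a ha)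
  refine contourIntegral_eq_zero_of_hasDerivAt hγ (F := fun w => Complex.log (1 + -w / a)) ?_
    (continuousOn_inv_sub ha)
  intro w hw
  have ha0 : a ≠ 0 := norm_pos_iff.1 ((norm_nonneg w).trans_lt (h w hw))
  have h1 : w - a ≠ 0 := fun h => ha (by rwa [← sub_eq_zero.1 h])
  have hs : 1 + -w / a ∈ Complex.slitPlane := by
    refine Complex.mem_slitPlane_of_norm_lt_one ?_
    rw [norm_div, norm_neg, div_lt_one (norm_pos_iff.2 ha0)]
    exact h w hw
  have hd : HasDerivAt (fun w => 1 + -w / a) (-1 / a) w :=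
    ((hasDerivAt_id w).neg.div_const a).const_add 1
  convert hd.clog hs using 1
  have h2 : 1 + -w / a ≠ 0 := Complex.slitPlane_ne_zero hs
  have h3 : a - w ≠ 0 := fun h => h1 (by linear_combination -h)
  rw [inv_eq_one_div, eq_div_iff h2]
  field_simp
  ring

/-- Contour integrals depend holomorphically on a parameter `z` if the integrand `F z w` is
holomorphic in `z`, continuous in `w`, and bounded. -/
theorem differentiableAt_contourIntegral {F : ℂ → ℂ → ℂ} {z₀ : ℂ} {δ M : ℝ} (hδ : 0 < δ)
    (hF : ∀ w ∈ γ '' Icc 0 1, DifferentiableOn ℂ (fun z => F z w) (Metric.ball z₀ δ))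
    (hc : ∀ z ∈ Metric.ball z₀ δ, ContinuousOn (F z) (γ '' Icc 0 1))
    (hM : ∀ w ∈ γ '' Icc 0 1, ∀ z ∈ Metric.ball z₀ δ, ‖F z w‖ ≤ M) :
    DifferentiableAt ℂ (fun z => contourIntegral γ (F z)) z₀ := by
  have hz₀ : z₀ ∈ Metric.ball z₀ δ := Metric.mem_ball_self hδ
  have hmem : Metric.ball z₀ (δ / 2) ∈ 𝓝 z₀ := Metric.ball_mem_nhds _ (by positivity)
  have hsub : ∀ x ∈ Metric.ball z₀ (δ / 2), Metric.closedBall x (δ / 3) ⊆ Metric.ball z₀ δ := by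
    intro x hx y hy
    rw [Metric.mem_ball] at hx ⊢
    rw [Metric.mem_closedBall] at hy
    linarith [dist_triangle y x z₀]
  have hder : ∀ w ∈ γ '' Icc 0 1, ∀ x ∈ Metric.ball z₀ δ,
      HasDerivAt (fun z => F z w) (deriv (fun z => F z w) x) x := fun w hw x hx =>
    ((hF w hw).differentiableAt (Metric.isOpen_ball.mem_nhds hx)).hasDerivAt
  have him : ∀ t ∈ uIoc (0 : ℝ) 1, γ t ∈ γ '' Icc 0 1 := by
    intro t ht
    rw [uIoc_of_le zero_le_one] at ht
    exact mem_image_of_mem γ (Ioc_subset_Icc_self ht)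
  have hmeas : ∀ z ∈ Metric.ball z₀ δ, AEStronglyMeasurable (fun t => F z (γ t) * deriv γ t)
      (volume.restrict (uIoc (0 : ℝ) 1)) := by
    intro z hz
    have := (hγ.intervalIntegrable_mul_deriv (hc z hz)).aestronglyMeasurable
    rwa [uIoc_of_le zero_le_one]
  refine DifferentiableAt.const_mul ?_ _
  refine (intervalIntegral.hasDerivAt_integral_of_dominated_loc_of_deriv_le
    (F := fun z t => F z (γ t) * deriv γ t)
    (F' := fun z t => deriv (fun x => F x (γ t)) z * deriv γ t)
    (bound := fun t => M / (δ / 3) * ‖deriv γ t‖) hmem ?_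
    (hγ.intervalIntegrable_mul_deriv (hc z₀ hz₀)) ?_ ?_
    (hγ.intervalIntegrable_deriv.norm.const_mul _) ?_).2.differentiableAt
  · filter_upwards [Metric.ball_mem_nhds z₀ hδ] with z hz using hmeas z hz
  · -- the derivative is measurable in `t` as a limit of difference quotients
    obtain ⟨u, -, hu0, hu⟩ := exists_seq_strictAnti_tendsto' (x := (0 : ℝ)) (y := δ) hδ
    have hball : ∀ n, z₀ + (u n : ℂ) ∈ Metric.ball z₀ δ := fun n => by
      simp [abs_of_pos (hu0 n).1, (hu0 n).2]
    refine aestronglyMeasurable_of_tendsto_ae atTop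
      (f := fun n t => (u n : ℂ)⁻¹ •
        (F (z₀ + (u n : ℂ)) (γ t) * deriv γ t - F z₀ (γ t) * deriv γ t)) (fun n => ?_) ?_
    · exact ((hmeas _ (hball n)).sub (hmeas _ hz₀)).const_smul (u n : ℂ)⁻¹
    · refine (ae_restrict_iff' measurableSet_uIoc).2 (Eventually.of_forall fun t ht => ?_)
      have h1 := (hder _ (him t ht) z₀ hz₀).mul_const (deriv γ t)
      refine h1.tendsto_slope_zero.comp (tendsto_nhdsWithin_iff.2 ⟨?_, ?_⟩)
      · have := (Complex.continuous_ofReal.tendsto 0).comp hu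
        simpa [Function.comp_def] using this
      · exact Eventually.of_forall fun n => by simpa using (hu0 n).1.ne'
  · refine Eventually.of_forall fun t ht x hx => ?_
    rw [norm_mul]
    refine mul_le_mul_of_nonneg_right ?_ (norm_nonneg _)
    refine Complex.norm_deriv_le_of_forall_mem_sphere_norm_le (by positivity) ?_ ?_
    · refine DifferentiableOn.diffContOnCl ?_
      exact (hF _ (him t ht)).mono
        ((Metric.closure_ball_subset_closedBall).trans (hsub x hx))
    · exact fun z hz => hM _ (him t ht) z (hsub x hx (Metric.sphere_subset_closedBall hz))
  · exact Eventually.of_forall fun t ht x hx => (hder _ (him t ht) x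
      (Metric.ball_subset_ball (by linarith) hx)).mul_const _

end

/-! ### Cauchy's theorem for null-homologous loops -/

/-- The difference quotients `(f w - f z) / (w - z)` of a holomorphic function, `w` in a compact
set, are bounded uniformly for `z` in a small disc. -/
theorem exists_norm_dslope_le {U K : Set ℂ} (hU : IsOpen U) {f : ℂ → ℂ}
    (hf : DifferentiableOn ℂ f U) (hK : IsCompact K) (hKU : K ⊆ U) {z₀ : ℂ} (hz₀ : z₀ ∈ U) :
    ∃ δ > 0, Metric.ball z₀ δ ⊆ U ∧ ∃ M, ∀ w ∈ K, ∀ z ∈ Metric.ball z₀ δ, ‖dslope f w z‖ ≤ M := by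
  obtain ⟨ρ, hρ, hball⟩ := Metric.nhds_basis_closedBall.mem_iff.1 (hU.mem_nhds hz₀)
  have hcomp : IsCompact (K ∪ Metric.closedBall z₀ ρ) := hK.union (isCompact_closedBall _ _)
  obtain ⟨B, hB⟩ := hcomp.exists_bound_of_continuousOn
    (hf.continuousOn.mono (union_subset hKU hball))
  have hest : ∀ w ∈ K, ∀ z ∈ Metric.closedBall z₀ ρ, ρ / 4 ≤ ‖z - w‖ →
      ‖dslope f w z‖ ≤ 2 * B / (ρ / 4) := by
    intro w hw z hz hd
    have hne : z ≠ w := by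
      rintro rfl
      simp only [sub_self, norm_zero] at hd
      linarith
    rw [dslope_of_ne _ hne, slope_def_field, norm_div]
    have h1 := norm_sub_le (f z) (f w)
    have h2 := hB z (Or.inr hz)
    have h3 := hB w (Or.inl hw)
    exact div_le_div₀ (by linarith [norm_nonneg (f z)]) (by linarith) (by positivity) hd
  refine ⟨ρ / 2, by positivity,
    (Metric.ball_subset_closedBall.trans (Metric.closedBall_subset_closedBall (by linarith))).trans
      hball, 2 * B / (ρ / 4), fun w hw z hz => ?_⟩
  rw [Metric.mem_ball, dist_eq_norm] at hz
  rcases le_total (3 * ρ / 4) ‖w - z₀‖ with h | h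
  · refine hest w hw z (by rw [Metric.mem_closedBall, dist_eq_norm]; linarith) ?_
    have := norm_sub_le_norm_sub_add_norm_sub w z z₀
    rw [norm_sub_rev w z] at this
    linarith
  · -- the maximum principle on the disc of radius `ρ`
    refine Complex.norm_le_of_forall_mem_frontier_norm_le (U := Metric.ball z₀ ρ)
      Metric.isBounded_ball ?_ ?_ ?_
    · refine DifferentiableOn.diffContOnCl ?_
      exact ((Complex.differentiableOn_dslope (hU.mem_nhds (hKU hw))).2 hf).mono
        (Metric.closure_ball_subset_closedBall.trans hball)
    · intro y hy
      rw [frontier_ball _ hρ.ne'] at hy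
      refine hest w hw y (Metric.sphere_subset_closedBall hy) ?_
      rw [mem_sphere_iff_norm] at hy
      have := norm_sub_le_norm_sub_add_norm_sub y w z₀
      linarith
    · refine subset_closure ?_
      rw [Metric.mem_ball, dist_eq_norm]
      linarith

theorem dslope_comm (f : ℂ → ℂ) (a b : ℂ) : dslope f a b = dslope f b a := by
  rcases eq_or_ne a b with rfl | h
  · rfl
  · rw [dslope_of_ne _ h, dslope_of_ne _ h.symm, slope_comm]

section

variable {γ : ℝ → ℂ} (hγ : IsPiecewiseC1Loop γ) {U : Set ℂ} (hU : IsOpen U)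
  (hγU : γ '' Icc 0 1 ⊆ U) (hw0 : ∀ a ∉ U, windingNumber γ a = 0)
include hγ hγU

theorem contourIntegral_dslope {f : ℂ → ℂ} (hf : DifferentiableOn ℂ f U) {z : ℂ}
    (hz : z ∉ γ '' Icc 0 1) (hz0 : windingNumber γ z = 0) :
    contourIntegral γ (dslope f z) = contourIntegral γ (fun w => f w * (w - z)⁻¹) := by
  have h1 : contourIntegral γ (dslope f z) =
      contourIntegral γ (fun w => f w * (w - z)⁻¹ + (-f z) * (w - z)⁻¹) := by
    refine contourIntegral_congr fun w hw => ?_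
    have : w ≠ z := fun h => hz (h ▸ hw)
    simp only [dslope_of_ne _ this, slope_def_field]
    ring
  have h2 : ContinuousOn (fun w => (-f z) * (w - z)⁻¹) (γ '' Icc 0 1) :=
    continuousOn_const.mul (continuousOn_inv_sub hz)
  rw [h1, contourIntegral_add hγ (continuousOn_div_sub hγU hf hz) h2,
    contourIntegral_const_mul]
  unfold windingNumber at hz0
  rw [hz0, mul_zero, add_zero]

include hU hw0 in
/-- Dixon's argument: the function equal to `∮ (f w - f z) / (w - z) dw` for `z ∈ U` and to
`∮ f w / (w - z) dw` for `z ∉ U` is entire and vanishes at infinity, so it is zero. -/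
theorem contourIntegral_div_sub_eq_zero {f : ℂ → ℂ} (hf : DifferentiableOn ℂ f U) {R : ℝ}
    (hR : ∀ w ∈ γ '' Icc 0 1, ‖w‖ ≤ R) {z : ℂ} (hz : R < ‖z‖) :
    contourIntegral γ (fun w => f w * (w - z)⁻¹) = 0 := by
  classical
  set H : ℂ → ℂ := fun z => if z ∈ U then contourIntegral γ (dslope f z)
    else contourIntegral γ (fun w => f w * (w - z)⁻¹) with hHdef
  have hH1 : ∀ z ∈ U, H z = contourIntegral γ (dslope f z) := fun z hz => if_pos hz
  have hH2 : ∀ z ∉ γ '' Icc 0 1, windingNumber γ z = 0 →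
      H z = contourIntegral γ (fun w => f w * (w - z)⁻¹) := by
    intro z hz hz0
    by_cases hzU : z ∈ U
    · rw [hH1 z hzU, contourIntegral_dslope hγ hγU hf hz hz0]
    · exact if_neg hzU
  have hfar : ∀ z, R < ‖z‖ → H z = contourIntegral γ (fun w => f w * (w - z)⁻¹) := fun z hz =>
    hH2 z (fun h => absurd (hR z h) (not_le.2 hz))
      (windingNumber_eq_zero_of_norm_lt hγ fun w hw => (hR w hw).trans_lt hz)
  have hdiff : Differentiable ℂ H := by
    intro z₀
    by_cases hzU : z₀ ∈ U
    · obtain ⟨δ, hδ, hδU, M, hM⟩ := exists_norm_dslope_le hU hf hγ.isCompact_image hγU hzU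
      have hd := differentiableAt_contourIntegral hγ (F := fun z w => dslope f z w) (z₀ := z₀) hδ
        (M := M) ?_ ?_ ?_
      · refine hd.congr_of_eventuallyEq ?_
        filter_upwards [hU.mem_nhds hzU] with z hz using hH1 z hz
      · intro w hw
        simp only [dslope_comm f _ w]
        exact ((Complex.differentiableOn_dslope (hU.mem_nhds (hγU hw))).2 hf).mono hδU
      · intro z hz
        exact ((Complex.differentiableOn_dslope
          (hU.mem_nhds (hδU hz))).2 hf).continuousOn.mono hγU
      · intro w hw z hz
        rw [dslope_comm]
        exact hM w hw z hz
    · have hz₀ : z₀ ∉ γ '' Icc 0 1 := fun h => hzU (hγU h)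
      obtain ⟨δ, hδ, hsub⟩ := Metric.nhds_basis_ball.mem_iff.1
        (hγ.isCompact_image.isClosed.isOpen_compl.mem_nhds hz₀)
      have hdist : ∀ w ∈ γ '' Icc 0 1, δ ≤ ‖w - z₀‖ := by
        intro w hw
        by_contra! h
        exact hsub (by rwa [Metric.mem_ball, dist_eq_norm]) hw
      obtain ⟨B, hB⟩ := hγ.isCompact_image.exists_bound_of_continuousOn (hf.continuousOn.mono hγU)
      have hd := differentiableAt_contourIntegral hγ (F := fun z w => f w * (w - z)⁻¹) (z₀ := z₀)
        (δ := δ / 2) (M := B * (δ / 2)⁻¹) (by positivity) ?_ ?_ ?_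
      · refine hd.congr_of_eventuallyEq ?_
        filter_upwards [Metric.ball_mem_nhds z₀ hδ] with z hz
        rw [Metric.mem_ball, dist_eq_norm] at hz
        refine hH2 z (hsub (by rwa [Metric.mem_ball, dist_eq_norm])) ?_
        rw [windingNumber_eq_of_norm_lt hγ hz₀ fun w hw => hz.trans_le (hdist w hw), hw0 z₀ hzU]
      · intro w hw z hz
        have : w - z ≠ 0 := by
          intro h
          rw [← sub_eq_zero.1 h] at hz
          exact hsub (Metric.ball_subset_ball (by linarith) hz) hw
        refine DifferentiableAt.differentiableWithinAt ?_
        fun_prop (disch := exact this)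
      · intro z hz
        exact continuousOn_div_sub hγU hf
          (hsub (Metric.ball_subset_ball (by linarith) hz))
      · intro w hw z hz
        rw [Metric.mem_ball, dist_eq_norm] at hz
        have h1 := hdist w hw
        have h2 := norm_sub_le_norm_sub_add_norm_sub w z z₀
        rw [norm_mul, norm_inv]
        have h3 := hB w hw
        exact mul_le_mul h3 (inv_anti₀ (by positivity) (by linarith)) (by positivity)
          ((norm_nonneg _).trans h3)
  have hlim : Tendsto H (cocompact ℂ) (𝓝 0) := by
    set I := ‖(2 * (Real.pi : ℂ) * Complex.I)⁻¹‖ * ∫ t in (0 : ℝ)..1, ‖f (γ t) * deriv γ t‖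
    have hbound : ∀ᶠ z in cocompact ℂ, ‖H z‖ ≤ I * (‖z‖ - R)⁻¹ := by
      filter_upwards [(tendsto_norm_cocompact_atTop (E := ℂ)).eventually_gt_atTop R] with z hz
      rw [hfar z hz, contourIntegral, norm_mul, show I * (‖z‖ - R)⁻¹ = _ from mul_assoc _ _ _]
      refine mul_le_mul_of_nonneg_left ?_ (norm_nonneg _)
      rw [← intervalIntegral.integral_mul_const]
      refine intervalIntegral.norm_integral_le_of_norm_le zero_le_one ?_
        ((hγ.intervalIntegrable_mul_deriv (hf.continuousOn.mono hγU)).norm.mul_const (‖z‖ - R)⁻¹)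
      refine Eventually.of_forall fun t ht => ?_
      have h1 := hR _ (mem_image_of_mem γ (Ioc_subset_Icc_self ht))
      have h2 : ‖z‖ - ‖γ t‖ ≤ ‖γ t - z‖ := by
        rw [norm_sub_rev]
        exact norm_sub_norm_le _ _
      rw [norm_mul, norm_mul, norm_mul, norm_inv, mul_right_comm]
      exact mul_le_mul_of_nonneg_left (inv_anti₀ (by linarith) (by linarith)) (by positivity)
    refine squeeze_zero_norm' hbound ?_
    rw [← mul_zero I]
    refine Tendsto.const_mul I (tendsto_inv_atTop_zero.comp ?_)
    exact tendsto_atTop_add_const_right _ _ tendsto_norm_cocompact_atTop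
  rw [← hfar z hz]
  exact hdiff.apply_eq_of_tendsto_cocompact z hlim

include hU hw0 in
/-- **Cauchy's theorem** for a loop which has winding number `0` around all points outside of
`U`. -/
theorem contourIntegral_eq_zero_of_differentiableOn {f : ℂ → ℂ} (hf : DifferentiableOn ℂ f U) :
    contourIntegral γ f = 0 := by
  obtain ⟨R, hR⟩ := hγ.isCompact_image.isBounded.exists_norm_le
  -- at a point `z` outside of the disc containing the loop, the preceding lemma for
  -- `(w - z) * f w` is the claim
  obtain ⟨z, hz⟩ : ∃ z : ℂ, R < ‖z‖ := NormedSpace.exists_lt_norm ℂ ℂ R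
  have h := contourIntegral_div_sub_eq_zero hγ hU hγU hw0 (f := fun w => (w - z) * f w)
    (by fun_prop) hR hz
  rw [← h]
  refine contourIntegral_congr fun w hw => ?_
  have : w - z ≠ 0 := by
    intro h
    rw [← sub_eq_zero.1 h] at hz
    exact absurd (hR w hw) (not_le.2 hz)
  field_simp

end

/-- The integral of `f w / (w - a) ^ m` over a null-homologous loop is a multiple of the winding
number around `a`, with a factor that does not depend on the loop. -/
theorem exists_contourIntegral_mul_inv_pow {U : Set ℂ} (hU : IsOpen U) {a : ℂ} (ha : a ∈ U) (m : ℕ)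
    {f : ℂ → ℂ} (hf : DifferentiableOn ℂ f U) :
    ∃ e : ℂ, ∀ γ : ℝ → ℂ, IsPiecewiseC1Loop γ → γ '' Icc 0 1 ⊆ U →
      (∀ b ∉ U, windingNumber γ b = 0) → a ∉ γ '' Icc 0 1 →
      contourIntegral γ (fun w => f w * ((w - a) ^ m)⁻¹) = e * windingNumber γ a := by
  induction m generalizing f with
  | zero =>
    refine ⟨0, fun γ hγ hγU hw0 _ => ?_⟩
    simpa using contourIntegral_eq_zero_of_differentiableOn hγ hU hγU hw0 hf
  | succ m ih =>
    have hf' := (Complex.differentiableOn_dslope (hU.mem_nhds ha)).2 hf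
    obtain ⟨e, he⟩ := ih hf'
    have hpow : ∃ e' : ℂ, ∀ γ : ℝ → ℂ, IsPiecewiseC1Loop γ → a ∉ γ '' Icc 0 1 →
        contourIntegral γ (fun w => ((w - a) ^ (m + 1))⁻¹) = e' * windingNumber γ a := by
      rcases Nat.eq_zero_or_pos m with rfl | hm
      · exact ⟨1, fun γ _ _ => by simp [windingNumber]⟩
      · refine ⟨0, fun γ hγ haγ => ?_⟩
        rw [zero_mul]
        refine contourIntegral_eq_zero_of_hasDerivAt hγ
          (F := fun w => -(m : ℂ)⁻¹ * ((w - a) ^ m)⁻¹) ?_ ?_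
        · intro w hw
          have h0 : w - a ≠ 0 := fun h => haγ (by rwa [← sub_eq_zero.1 h])
          have hd : HasDerivAt (fun w => (w - a) ^ m) (m * (w - a) ^ (m - 1) * 1) w :=
            ((hasDerivAt_id w).sub_const a).pow m
          have hd' : HasDerivAt (fun w => -(m : ℂ)⁻¹ * ((w - a) ^ m)⁻¹)
              (-(m : ℂ)⁻¹ * (-(m * (w - a) ^ (m - 1) * 1) / ((w - a) ^ m) ^ 2)) w :=
            (hd.inv (pow_ne_zero m h0)).const_mul _
          refine hd'.congr_deriv ?_
          have hm' : (m : ℂ) ≠ 0 := by exact_mod_cast hm.ne'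
          obtain ⟨k, rfl⟩ : ∃ k, m = k + 1 := ⟨m - 1, by omega⟩
          rw [Nat.add_sub_cancel]
          field_simp
          ring
        · simp only [← inv_pow]
          exact (continuousOn_inv_sub haγ).pow _
    obtain ⟨e', he'⟩ := hpow
    refine ⟨f a * e' + e, fun γ hγ hγU hw0 haγ => ?_⟩
    have hc : ∀ k : ℕ, ContinuousOn (fun w => ((w - a) ^ k)⁻¹) (γ '' Icc 0 1) := fun k => by
      simp only [← inv_pow]
      exact (continuousOn_inv_sub haγ).pow _
    have hc1 : ContinuousOn (fun w => f a * ((w - a) ^ (m + 1))⁻¹) (γ '' Icc 0 1) :=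
      continuousOn_const.mul (hc _)
    have hc2 : ContinuousOn (fun w => dslope f a w * ((w - a) ^ m)⁻¹) (γ '' Icc 0 1) :=
      (hf'.continuousOn.mono hγU).mul (hc m)
    rw [show contourIntegral γ (fun w => f w * ((w - a) ^ (m + 1))⁻¹) =
        contourIntegral γ (fun w => f a * ((w - a) ^ (m + 1))⁻¹ +
          dslope f a w * ((w - a) ^ m)⁻¹) from contourIntegral_congr fun w hw => ?_,
      contourIntegral_add hγ hc1 hc2, contourIntegral_const_mul, he' γ hγ haγ,
      he γ hγ hγU hw0 haγ]
    · ring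
    · have h0 : w ≠ a := fun h => haγ (h ▸ hw)
      have h1 : w - a ≠ 0 := sub_ne_zero.2 h0
      simp only [dslope_of_ne _ h0, slope_def_field]
      field_simp
      ring

/-! ### Laurent series with finite principal part -/

theorem hasSum_int_iff_of_eq_zero {f : ℤ → ℂ} {N : ℤ} (h : ∀ m, N < m → f m = 0) {a : ℂ} :
    HasSum (fun j : ℕ => f (N - j)) a ↔ HasSum f a := by
  have hinj : Function.Injective (fun j : ℕ => N - (j : ℤ)) := fun i j hij => by
    simp only at hij
    omega
  refine hinj.hasSum_iff fun m hm => h m ?_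
  by_contra! hle
  exact hm ⟨(N - m).toNat, by simp only; omega⟩

theorem hasFPowerSeriesOnBall_tsum {b : ℕ → ℂ} {R : ℝ} (hR : 0 < R)
    (hs : ∀ y : ℂ, y ≠ 0 → ‖y‖ < R → Summable fun j => y ^ j * b j) (c : ℂ) :
    HasFPowerSeriesOnBall (fun x => ∑' j, (x - c) ^ j * b j) (FormalMultilinearSeries.ofScalars ℂ b)
      c (ENNReal.ofReal R) where
  r_le := by
    refine ENNReal.le_of_forall_nnreal_lt fun r hr => ?_
    rcases eq_or_ne r 0 with rfl | hr0
    · simp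
    have hrR : (r : ℝ) < R := by
      rw [← ENNReal.ofReal_coe_nnreal] at hr
      exact (ENNReal.ofReal_lt_ofReal_iff hR).1 hr
    have hsum := hs (r : ℝ) (by simpa using hr0) (by simpa using hrR)
    refine FormalMultilinearSeries.le_radius_of_tendsto _ (l := 0) ?_
    have := hsum.tendsto_atTop_zero.norm
    simpa [FormalMultilinearSeries.ofScalars_norm, mul_comm] using this
  r_pos := by simpa using hR
  hasSum := by
    intro y hy
    have hy' : ‖y‖ < R := by
      rw [Metric.eball_ofReal] at hy
      simpa using hy
    simp only [add_sub_cancel_left, FormalMultilinearSeries.ofScalars_apply_eq, smul_eq_mul]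
    have hsum : Summable fun j => y ^ j * b j := by
      rcases eq_or_ne y 0 with rfl | h0
      · exact summable_of_ne_finset_zero (s := {0}) fun j hj => by
          simp [zero_pow (by simpa using hj : j ≠ 0)]
      · exact hs y h0 hy'
    simpa [mul_comm] using hsum.hasSum

/-- Cauchy's estimate for the coefficients of a power series. -/
theorem norm_coeff_le_of_forall_mem_sphere {b : ℕ → ℂ} {R ρ M : ℝ} (hρ : 0 < ρ) (hρR : ρ < R)
    {F : ℂ → ℂ} {c : ℂ}
    (hF : ∀ x, x ≠ c → ‖x - c‖ < R → HasSum (fun j : ℕ => (x - c) ^ j * b j) (F x))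
    (hM : ∀ x ∈ Metric.sphere c ρ, ‖F x‖ ≤ M) (n : ℕ) : ‖b n‖ ≤ M / ρ ^ n := by
  have hR : 0 < R := hρ.trans hρR
  have hp := hasFPowerSeriesOnBall_tsum (b := b) hR (fun y hy0 hy => by
    simpa using (hF (c + y) (by simpa using hy0) (by simpa using hy)).summable) c
  have hd : DifferentiableOn ℂ (fun x => ∑' j, (x - c) ^ j * b j) (Metric.ball c R) := by
    have := hp.differentiableOn
    rwa [Metric.eball_ofReal] at this
  have h1 := Complex.norm_iteratedDeriv_le_of_forall_mem_sphere_norm_le (C := M) n hρ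
    ((hd.mono (Metric.closure_ball_subset_closedBall.trans
      (Metric.closedBall_subset_ball hρR))).diffContOnCl) fun x hx => ?_
  · have h2 := hp.factorial_smul 1 n
    rw [← iteratedDeriv_eq_iteratedFDeriv] at h2
    rw [← h2] at h1
    simp only [FormalMultilinearSeries.ofScalars_apply_eq, one_pow, smul_eq_mul, mul_one,
      nsmul_eq_mul, norm_mul, Complex.norm_natCast] at h1
    rw [mul_div_assoc] at h1
    exact le_of_mul_le_mul_left h1 (by positivity)
  · have hx' : ‖x - c‖ = ρ := by simpa [dist_eq_norm] using hx
    have hne : x ≠ c := by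
      rintro rfl
      simp at hx'
      linarith
    rw [(hF x hne (hx' ▸ hρR)).tsum_eq]
    exact hM x hx

/-- Re-expansion of a family of Laurent series about another centre: if
`h ζ w = ∑_m (ζ - w)^{-m} g_m(w)`, then
`h z w = ∑_q (w - z)^{-q} ∑_k (-1)^{q+k} / k! g_{q+k}^{(k)}(z)`. -/
theorem hasSum_reexpand {g : ℤ → ℂ → ℂ} {h : ℂ → ℂ → ℂ} {N : ℤ} (hN : ∀ m, N < m → g m = 0)
    {z : ℂ} {ρ R M : ℝ} (hρ : 0 < ρ) (hρR : ρ < R)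
    (hg : ∀ m, DifferentiableOn ℂ (g m) (Metric.closedBall z ρ))
    (hh : ∀ w ∈ Metric.closedBall z ρ, ∀ ζ, ζ ≠ w → ‖ζ - w‖ < R →
      HasSum (fun m : ℤ => (ζ - w) ^ (-m) * g m w) (h ζ w))
    (hM : ∀ w ∈ Metric.closedBall z ρ, ∀ ζ ∈ Metric.sphere w ρ, ‖h ζ w‖ ≤ M)
    {w : ℂ} (hwz : w ≠ z) (hw : ‖w - z‖ < ρ) :
    HasSum (fun q : ℤ => (w - z) ^ (-q) * ∑ᶠ k : ℕ, ((-1 : ℂ) ^ (q + (k : ℤ)) / (k.factorial : ℂ)) *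
      iteratedDeriv k (g (q + k)) z) (h z w) := by
  have hz0 : z - w ≠ 0 := sub_ne_zero.2 hwz.symm
  have hw0 : w - z ≠ 0 := sub_ne_zero.2 hwz
  have hM0 : 0 ≤ M := (norm_nonneg _).trans
    (hM z (Metric.mem_closedBall_self hρ.le) (z + ρ) (by simp [abs_of_pos hρ]))
  have hbound : ∀ (j : ℕ), ∀ v ∈ Metric.closedBall z ρ,
      ‖g (N - j) v‖ ≤ M * ρ ^ N / ρ ^ j := by
    intro j v hv
    refine norm_coeff_le_of_forall_mem_sphere (b := fun j => g (N - j) v)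
      (F := fun x => (x - v) ^ N * h x v) (c := v) hρ hρR ?_ ?_ j
    · intro x hx hxR
      have hx0 : x - v ≠ 0 := sub_ne_zero.2 hx
      have h1 := (hasSum_int_iff_of_eq_zero (N := N) (fun m hm => by simp [hN m hm])).2
        (hh v hv x hx hxR)
      refine (h1.mul_left ((x - v) ^ N)).congr_fun fun j => ?_
      rw [← mul_assoc, ← zpow_add₀ hx0]
      simp
    · intro x hx
      have hx' : ‖x - v‖ = ρ := by simpa [dist_eq_norm] using hx
      rw [norm_mul, norm_zpow, hx', mul_comm]
      exact mul_le_mul_of_nonneg_right (hM v hv x hx) (by positivity)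
  have hder : ∀ j k : ℕ, ‖iteratedDeriv k (g (N - j)) z‖ ≤
      k.factorial * (M * ρ ^ N / ρ ^ j) / ρ ^ k := fun j k =>
    Complex.norm_iteratedDeriv_le_of_forall_mem_sphere_norm_le k hρ
      ((hg _).mono Metric.closure_ball_subset_closedBall).diffContOnCl
      fun v hv => hbound j v (Metric.sphere_subset_closedBall hv)
  -- the double series: term `p.2` of the Taylor expansion about `z` of term `m = N - p.1`
  set a : ℕ × ℕ → ℂ := fun p => (z - w) ^ (-(N - (p.1 : ℤ))) *
    (((p.2.factorial : ℂ))⁻¹ * ((w - z) ^ p.2 * iteratedDeriv p.2 (g (N - p.1)) z)) with ha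
  have hsum : Summable a := by
    set x := ‖w - z‖ / ρ
    have hx0 : 0 ≤ x := by positivity
    have hx1 : x < 1 := (div_lt_one hρ).2 hw
    have hgeo := summable_geometric_of_lt_one hx0 hx1
    have hprod := (hgeo.mul_of_nonneg hgeo (fun _ => by positivity) fun _ => by positivity)
    refine Summable.of_norm_bounded (hprod.mul_left (‖w - z‖ ^ (-N) * (M * ρ ^ N)))
      fun ⟨j, k⟩ => ?_
    simp only [ha, norm_mul, norm_zpow, norm_pow, norm_inv, Complex.norm_natCast]
    rw [norm_sub_rev z w, show -(N - (j : ℤ)) = j + -N by ring, zpow_add₀ (norm_ne_zero_iff.2 hw0),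
      zpow_natCast]
    calc _ ≤ ‖w - z‖ ^ j * ‖w - z‖ ^ (-N) * ((k.factorial : ℝ)⁻¹ * (‖w - z‖ ^ k *
            (k.factorial * (M * ρ ^ N / ρ ^ j) / ρ ^ k))) := by
          gcongr
          exact hder j k
      _ = _ := by
          have : (k.factorial : ℝ) ≠ 0 := by positivity
          simp only [x, div_pow]
          field_simp
  have hrow : ∀ j : ℕ, HasSum (fun k => a (j, k)) ((z - w) ^ (-(N - (j : ℤ))) * g (N - j) w) := by
    intro j
    have := Complex.hasSum_taylorSeries_on_ball ((hg (N - j)).mono Metric.ball_subset_closedBall)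
      (z := w) (by simpa [dist_eq_norm] using hw)
    simp only [smul_eq_mul] at this
    have h1 := this.mul_left ((z - w) ^ (-(N - (j : ℤ))))
    simp only [ha]
    exact h1
  -- summing `a` along rows gives the series for `h z w`, along antidiagonals the claimed series
  have htot : HasSum a (h z w) := by
    have h1 := hsum.hasSum.prod_fiberwise hrow
    have h2 := (hasSum_int_iff_of_eq_zero (N := N) (fun m hm => by simp [hN m hm])).2
      (hh w (by simpa [dist_eq_norm] using hw.le) z hwz.symm
        (by rw [norm_sub_rev]; exact hw.trans hρR))
    rw [← h1.unique h2]
    exact hsum.hasSum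
  clear hsum hrow hder hbound
  have hanti : HasSum (fun n : ℕ => ∑ p ∈ Finset.HasAntidiagonal.antidiagonal n, a p) (h z w) := by
    rw [← Finset.HasAntidiagonal.sigmaAntidiagonalEquivProd.hasSum_iff] at htot
    refine htot.sigma fun n => ?_
    rw [← Finset.sum_coe_sort]
    exact hasSum_fintype _
  refine (hasSum_int_iff_of_eq_zero (N := N) ?_).1 (hanti.congr_fun fun n => ?_)
  · intro m hm
    have : ∀ k : ℕ, g (m + k) = 0 := fun k => hN _ (by omega)
    simp [this]
  · rw [finsum_eq_sum_of_support_subset (s := Finset.range (n + 1)), Finset.mul_sum,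
      Finset.Nat.antidiagonal_eq_map', Finset.sum_map]
    · refine Finset.sum_congr rfl fun k hk => ?_
      have hk' : k ≤ n := by simpa [Nat.lt_succ_iff] using hk
      change _ = a (n - k, k)
      simp only [ha]
      have hl : N - (n : ℤ) + k = N - ((n - k : ℕ) : ℤ) := by
        push_cast [Nat.cast_sub hk']
        ring
      rw [← hl]
      generalize N - (n : ℤ) = l
      rw [show z - w = -1 * (w - z) by ring, mul_zpow, show -l = -(l + k) + k by ring,
        zpow_add₀ hw0, zpow_natCast, show (-1 : ℂ) ^ (-(l + (k : ℤ))) = (-1) ^ (l + (k : ℤ)) by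
          rw [zpow_neg, ← inv_zpow, inv_neg, inv_one]]
      rw [div_eq_mul_inv]
      ring
    · intro k hk
      rw [Function.mem_support] at hk
      by_contra hkn
      have hkn' : n + 1 ≤ k := by simpa using hkn
      refine hk ?_
      rw [hN _ (by omega)]
      simp

/-! ### Correlation functions -/

section

variable {V : Type*}

theorem distinctPoints_append_cons {X Y : List (V × ℂ)} {A : V} {w : ℂ} :
    DistinctPoints (X ++ (A, w) :: Y) ↔ DistinctPoints (X ++ Y) ∧ ∀ P ∈ X ++ Y, P.2 ≠ w := by
  unfold DistinctPoints
  rw [List.map_append, List.map_cons, List.nodup_middle, List.nodup_cons, ← List.map_append,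
    and_comm]
  simp only [List.mem_map, not_exists, not_and, ne_eq]

theorem distinctPoints_append_cons_cons {X Y : List (V × ℂ)} {A B : V} {z w : ℂ} :
    DistinctPoints (X ++ (A, z) :: (B, w) :: Y) ↔ DistinctPoints (X ++ Y) ∧
      (∀ P ∈ X ++ Y, P.2 ≠ z) ∧ (∀ P ∈ X ++ Y, P.2 ≠ w) ∧ w ≠ z := by
  rw [distinctPoints_append_cons, distinctPoints_append_cons]
  simp only [List.mem_append, List.mem_cons]
  constructor
  · rintro ⟨⟨h1, h2⟩, h3⟩
    exact ⟨h1, fun P hP => h3 P (by tauto), h2, h3 (B, w) (by simp)⟩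
  · rintro ⟨h1, h2, h3, h4⟩
    refine ⟨⟨h1, h3⟩, ?_⟩
    rintro P (hP | rfl | hP)
    exacts [h2 P (Or.inl hP), h4, h2 P (Or.inr hP)]

theorem distinctPoints_insertions {n : ℕ} {T : Fin n → V} {z : Fin n → ℂ} :
    DistinctPoints (insertions T z) ↔ Function.Injective z := by
  unfold DistinctPoints insertions
  rw [List.map_ofFn, List.nodup_ofFn]
  rfl

theorem insertions_update {n : ℕ} (T : Fin n → V) (z : Fin n → ℂ) (i : Fin n) (A : V) :
    insertions (Function.update T i A) z =
      (insertions T z).take i ++ (A, z i) :: (insertions T z).drop (i + 1) := by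
  have hi : (i : ℕ) < (insertions T z).length := by simp [insertions]
  have hset : (insertions T z).take i ++ (A, z i) :: (insertions T z).drop (i + 1) =
      (insertions T z).set i (A, z i) := by
    rw [List.set_eq_take_append_cons_drop, if_pos hi]
  rw [hset]
  refine List.ext_getElem (by simp [insertions]) fun j h1 h2 => ?_
  rw [List.getElem_set]
  have hj : j < n := by simpa [insertions] using h1
  split_ifs with h
  · have : i = ⟨j, hj⟩ := Fin.ext h
    subst this
    simp [insertions]
  · have : (⟨j, hj⟩ : Fin n) ≠ i := fun h' => h (by rw [← h'])
    simp [insertions, Function.update_of_ne this]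

end

namespace OPEAlgebra.IsCorrelator

variable {V : Type*} [AddCommGroup V] [Module ℂ V] {𝒜 : OPEAlgebra V} {corr : List (V × ℂ) → ℂ}
  (hcorr : 𝒜.IsCorrelator corr)
include hcorr

/-- A correlation function as a linear function of one of the operators. -/
def linearMap (X Y : List (V × ℂ)) (w : ℂ) (hX : DistinctPoints (X ++ Y))
    (hw : ∀ P ∈ X ++ Y, P.2 ≠ w) : V →ₗ[ℂ] ℂ where
  toFun A := corr (X ++ (A, w) :: Y)
  map_add' A B := hcorr.map_add X Y A B w (distinctPoints_append_cons.2 ⟨hX, hw⟩)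
  map_smul' c A := hcorr.map_smul X Y c A w (distinctPoints_append_cons.2 ⟨hX, hw⟩)

theorem differentiableOn (X Y : List (V × ℂ)) (hX : DistinctPoints (X ++ Y)) (A : V) :
    DifferentiableOn ℂ (fun w => corr (X ++ (A, w) :: Y)) {w | ∀ P ∈ X ++ Y, P.2 ≠ w} :=
  fun w hw => (hcorr.hasDerivAt X Y A w (distinctPoints_append_cons.2
    ⟨hX, hw⟩)).differentiableAt.differentiableWithinAt

theorem iteratedDeriv_eq (X Y : List (V × ℂ)) (hX : DistinctPoints (X ++ Y)) (A : V) (k : ℕ)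
    {w : ℂ} (hw : ∀ P ∈ X ++ Y, P.2 ≠ w) :
    iteratedDeriv k (fun w => corr (X ++ (A, w) :: Y)) w =
      corr (X ++ ((𝒜.deriv ^ k) A, w) :: Y) := by
  induction k generalizing w with
  | zero => simp
  | succ k ih =>
    have hev : iteratedDeriv k (fun w => corr (X ++ (A, w) :: Y)) =ᶠ[𝓝 w]
        fun w => corr (X ++ ((𝒜.deriv ^ k) A, w) :: Y) := by
      have hfin : {P : V × ℂ | P ∈ X ++ Y}.Finite := (X ++ Y).finite_toSet
      filter_upwards [(eventually_all_finite hfin).2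
        fun P hP => eventually_ne_nhds (hw P hP).symm] with v hv
      exact ih fun P hP => (hv P hP).symm
    rw [iteratedDeriv_succ, hev.deriv_eq, (hcorr.hasDerivAt X Y _ w
      (distinctPoints_append_cons.2 ⟨hX, hw⟩)).deriv, pow_succ']
    rfl

theorem continuousOn {α : Type*} [TopologicalSpace α] (L : List (V × (α → ℂ)))
    (hL : ∀ P ∈ L, Continuous P.2) {S : Set α}
    (hS : ∀ a ∈ S, DistinctPoints (L.map fun P => (P.1, P.2 a))) :
    ContinuousOn (fun a => corr (L.map fun P => (P.1, P.2 a))) S := by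
  have heq : ∀ a, L.map (fun P => (P.1, P.2 a)) =
      insertions (fun i : Fin L.length => L[i].1) (fun i => L[i].2 a) := fun a =>
    List.ext_getElem (by simp [insertions]) fun j h1 h2 => by simp [insertions]
  simp only [heq] at hS ⊢
  refine (hcorr.holomorphic _ _).continuousOn.comp
    (f := fun a (i : Fin L.length) => L[i].2 a) ?_ fun a ha => distinctPoints_insertions.1 (hS a ha)
  exact (continuous_pi fun i => hL _ (List.getElem_mem _)).continuousOn

/-- Operators commute up to the sign of their parities when their points are close to each other:
the OPE of `A(z) B(w)`, re-expanded about `z`, is by the commutation rule for the brackets the OPE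
of `B(w) A(z)`. -/
theorem exists_swap_of_norm_lt (X Y : List (V × ℂ)) (hX : DistinctPoints (X ++ Y)) {A B : V}
    {a b : ZMod 2} (hA : A ∈ 𝒜.parity a) (hB : B ∈ 𝒜.parity b) {z : ℂ}
    (hz : ∀ P ∈ X ++ Y, P.2 ≠ z) :
    ∃ ρ > 0, ∀ w, w ≠ z → ‖w - z‖ < ρ → (∀ P ∈ X ++ Y, P.2 ≠ w) ∧
      corr (X ++ (B, w) :: (A, z) :: Y) = parSign a b * corr (X ++ (A, z) :: (B, w) :: Y) := by
  classical
  obtain ⟨d, hd, hdP⟩ : ∃ d > 0, ∀ P ∈ X ++ Y, d ≤ ‖P.2 - z‖ := by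
    have hfin : {P : V × ℂ | P ∈ X ++ Y}.Finite := (X ++ Y).finite_toSet
    have : ∀ᶠ d in 𝓝[>] (0 : ℝ), ∀ P ∈ {P : V × ℂ | P ∈ X ++ Y}, d ≤ ‖P.2 - z‖ :=
      (eventually_all_finite hfin).2 fun P hP => mem_nhdsWithin_of_mem_nhds
        (Iic_mem_nhds (norm_pos_iff.2 (sub_ne_zero.2 (hz P hP))))
    obtain ⟨d, h1, h2⟩ := (this.and self_mem_nhdsWithin).exists
    exact ⟨d, h2, h1⟩
  -- points `w` with `‖w - z‖ ≤ d / 4` have distance at least `3 d / 4` to the other points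
  have hdw : ∀ w ∈ Metric.closedBall z (d / 4), ∀ P ∈ X ++ Y, 3 * d / 4 ≤ ‖P.2 - w‖ := by
    intro w hw P hP
    rw [mem_closedBall_iff_norm] at hw
    have h1 := norm_sub_le_norm_sub_add_norm_sub P.2 w z
    have h2 := hdP P hP
    linarith
  have hne : ∀ w ∈ Metric.closedBall z (d / 4), ∀ P ∈ X ++ Y, P.2 ≠ w := by
    intro w hw P hP h
    have := hdw w hw P hP
    rw [h, sub_self, norm_zero] at this
    linarith
  have hneζ : ∀ w ∈ Metric.closedBall z (d / 4), ∀ ζ, ‖ζ - w‖ < d / 2 →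
      ∀ P ∈ X ++ Y, P.2 ≠ ζ := by
    intro w hw ζ hζ P hP h
    have := hdw w hw P hP
    rw [h] at this
    linarith
  obtain ⟨N, hN⟩ := 𝒜.bracket_eq_zero_of_large A B
  have hzero : ∀ m, N < m → ∀ w ∈ Metric.closedBall z (d / 4),
      corr (X ++ (𝒜.bracket m A B, w) :: Y) = 0 := by
    intro m hm w hw
    rw [hN m hm]
    exact map_zero (hcorr.linearMap X Y w hX (hne w hw))
  -- the convention `g m = 0` for `m > N` only matters at points of `X ++ Y`
  set g : ℤ → ℂ → ℂ := fun m => if m ≤ N then fun w => corr (X ++ (𝒜.bracket m A B, w) :: Y)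
    else 0 with hgdef
  have hg0 : ∀ m, N < m → g m = 0 := fun m hm => if_neg (not_le.2 hm)
  have hg1 : ∀ m, m ≤ N → g m = fun w => corr (X ++ (𝒜.bracket m A B, w) :: Y) :=
    fun m hm => if_pos hm
  have hgw : ∀ m, ∀ w ∈ Metric.closedBall z (d / 4),
      g m w = corr (X ++ (𝒜.bracket m A B, w) :: Y) := by
    intro m w hw
    rcases le_or_gt m N with hm | hm
    · rw [hg1 m hm]
    · rw [hg0 m hm, hzero m hm w hw, Pi.zero_apply]
  have hzb : z ∈ Metric.closedBall z (d / 4) := Metric.mem_closedBall_self (by positivity)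
  have hgiter : ∀ m k, iteratedDeriv k (g m) z =
      corr (X ++ ((𝒜.deriv ^ k) (𝒜.bracket m A B), z) :: Y) := by
    intro m k
    rcases le_or_gt m N with hm | hm
    · rw [hg1 m hm, hcorr.iteratedDeriv_eq X Y hX _ k hz]
    · rw [hg0 m hm, hN m hm, _root_.map_zero]
      refine Eq.trans ?_ (map_zero (hcorr.linearMap X Y z hX hz)).symm
      simp [Pi.zero_def]
  obtain ⟨M, hM⟩ : ∃ M, ∀ w ∈ Metric.closedBall z (d / 4), ∀ ζ ∈ Metric.sphere w (d / 4),
      ‖corr (X ++ (A, ζ) :: (B, w) :: Y)‖ ≤ M := by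
    have hK : IsCompact (Metric.sphere (0 : ℂ) (d / 4) ×ˢ Metric.closedBall z (d / 4)) :=
      (isCompact_sphere _ _).prod (isCompact_closedBall _ _)
    have hlist : ∀ q : ℂ × ℂ, (X.map (fun P => (P.1, fun _ : ℂ × ℂ => P.2)) ++
        (A, fun q : ℂ × ℂ => q.2 + q.1) :: (B, fun q : ℂ × ℂ => q.2) ::
          Y.map (fun P => (P.1, fun _ : ℂ × ℂ => P.2))).map (fun P => (P.1, P.2 q)) =
        X ++ (A, q.2 + q.1) :: (B, q.2) :: Y := fun q => by simp [Function.comp_def]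
    have hcont := hcorr.continuousOn (X.map (fun P => (P.1, fun _ : ℂ × ℂ => P.2)) ++
        (A, fun q : ℂ × ℂ => q.2 + q.1) :: (B, fun q : ℂ × ℂ => q.2) ::
          Y.map (fun P => (P.1, fun _ : ℂ × ℂ => P.2))) ?_
        (S := Metric.sphere (0 : ℂ) (d / 4) ×ˢ Metric.closedBall z (d / 4)) ?_
    · simp only [hlist] at hcont
      obtain ⟨M, hM⟩ := hK.exists_bound_of_continuousOn hcont
      refine ⟨M, fun w hw ζ hζ => ?_⟩
      have := hM (ζ - w, w) ⟨by simpa [dist_eq_norm] using hζ, hw⟩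
      simpa using this
    · intro P hP
      simp only [List.mem_append, List.mem_map, List.mem_cons] at hP
      rcases hP with ⟨Q, -, rfl⟩ | rfl | rfl | ⟨Q, -, rfl⟩ <;> fun_prop
    · rintro ⟨y, w⟩ ⟨hy, hw⟩
      have hy' : ‖y‖ = d / 4 := by simpa using hy
      rw [hlist, distinctPoints_append_cons_cons]
      refine ⟨hX, hneζ w hw _ ?_, hne w hw, ?_⟩
      · simp only [add_sub_cancel_left, hy']
        linarith
      · intro h
        have : y = 0 := by simpa using h
        rw [this, norm_zero] at hy'
        linarith
  refine ⟨d / 4, by positivity, fun w hwz hw => ?_⟩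
  have hwb : w ∈ Metric.closedBall z (d / 4) := mem_closedBall_iff_norm.2 hw.le
  refine ⟨hne w hwb, ?_⟩
  have h1 := hasSum_reexpand (g := g) (h := fun ζ w => corr (X ++ (A, ζ) :: (B, w) :: Y)) (N := N)
    (z := z) (ρ := d / 4) (R := d / 2) (M := M) hg0 (by positivity) (by linarith) ?_ ?_ hM hwz hw
  · have h2 := hcorr.ope X Y B A w z (distinctPoints_append_cons_cons.2
      ⟨hX, hne w hwb, hz, hwz.symm⟩) fun P hP => by linarith [hdP P hP]
    refine h2.unique ((h1.mul_left (parSign a b)).congr_fun fun q => ?_)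
    rw [mul_left_comm]
    congr 1
    have hvan : ∀ k : ℕ, k ∉ Finset.range ((N - q).toNat + 1) →
        𝒜.bracket (q + (k : ℤ)) A B = 0 := by
      intro k hk
      rw [Finset.mem_range, not_lt] at hk
      exact hN _ (by omega)
    rw [𝒜.comm a b A hA B hB q,
      finsum_eq_sum_of_support_subset (s := Finset.range ((N - q).toNat + 1)),
      finsum_eq_sum_of_support_subset (s := Finset.range ((N - q).toNat + 1))]
    · refine ((hcorr.linearMap X Y z hX hz).map_smul _ _).trans ?_
      rw [_root_.map_sum, smul_eq_mul]
      congr 1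
      refine Finset.sum_congr rfl fun k _ => ?_
      rw [hgiter, _root_.map_smul, smul_eq_mul]
      rfl
    · intro k hk
      by_contra hk'
      rw [Function.mem_support, hgiter, hvan k hk', _root_.map_zero] at hk
      refine hk ?_
      rw [show corr (X ++ ((0 : V), z) :: Y) = 0 from map_zero (hcorr.linearMap X Y z hX hz),
        mul_zero]
    · intro k hk
      by_contra hk'
      rw [Function.mem_support, hvan k hk', _root_.map_zero, smul_zero] at hk
      exact hk rfl
  · intro m
    refine DifferentiableOn.congr ?_ (hgw m)
    exact (hcorr.differentiableOn X Y hX _).mono hne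
  · intro v hv ζ hζ hζd
    refine (hcorr.ope X Y A B ζ v (distinctPoints_append_cons_cons.2
      ⟨hX, hneζ v hv ζ hζd, hne v hv, hζ.symm⟩) fun P hP => ?_).congr_fun fun m => ?_
    · linarith [hdw v hv P hP]
    · rw [hgw m v hv]

/-- Operators commute up to the sign of their parities: by analytic continuation in `w`, as the
complement of finitely many points is connected. -/
theorem swap (X Y : List (V × ℂ)) {A B : V} {a b : ZMod 2} (hA : A ∈ 𝒜.parity a)
    (hB : B ∈ 𝒜.parity b) {z w : ℂ} (hd : DistinctPoints (X ++ (B, w) :: (A, z) :: Y)) :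
    corr (X ++ (B, w) :: (A, z) :: Y) = parSign a b * corr (X ++ (A, z) :: (B, w) :: Y) := by
  obtain ⟨hX, hw, hz, hzw⟩ := distinctPoints_append_cons_cons.1 hd
  obtain ⟨ρ, hρ, h⟩ := hcorr.exists_swap_of_norm_lt X Y hX hA hB hz
  set S : Set ℂ := {v | ∃ P ∈ X ++ (A, z) :: Y, P.2 = v} with hS
  have hSfin : S.Finite := ((X ++ (A, z) :: Y).finite_toSet).image Prod.snd
  have hSmem : ∀ v, v ∉ S ↔ v ≠ z ∧ ∀ P ∈ X ++ Y, P.2 ≠ v := by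
    intro v
    simp only [hS, mem_ofPred_eq, not_exists, not_and, List.mem_append, List.mem_cons]
    constructor
    · exact fun h => ⟨fun hv => h (A, z) (Or.inr (Or.inl rfl)) hv.symm,
        fun P hP => h P (by tauto)⟩
    · rintro ⟨h1, h2⟩ P (hP | rfl | hP)
      exacts [h2 P (Or.inl hP), h1.symm, h2 P (Or.inr hP)]
  have hopen : IsOpen Sᶜ := hSfin.isClosed.isOpen_compl
  have hX' : DistinctPoints (X ++ (A, z) :: Y) := distinctPoints_append_cons.2 ⟨hX, hz⟩
  have hd1 : DifferentiableOn ℂ (fun v => corr (X ++ (B, v) :: (A, z) :: Y)) Sᶜ :=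
    (hcorr.differentiableOn X ((A, z) :: Y) hX' B).mono fun v hv P hP h => hv ⟨P, hP, h⟩
  have hd2 : DifferentiableOn ℂ (fun v => parSign a b * corr (X ++ (A, z) :: (B, v) :: Y)) Sᶜ := by
    have := hcorr.differentiableOn (X ++ [(A, z)]) Y (by simpa using hX') B
    simp only [List.append_assoc, List.cons_append, List.nil_append] at this
    refine DifferentiableOn.const_mul (this.mono ?_) _
    exact fun v (hv : v ∉ S) P hP h => hv ⟨P, hP, h⟩
  have hconn : IsPreconnected Sᶜ :=
    (hSfin.countable.isConnected_compl_of_one_lt_rank (by simp)).isPreconnected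
  have hv0 : z + (ρ / 2 : ℝ) ∈ {v : ℂ | v ≠ z ∧ ‖v - z‖ < ρ} := by
    refine ⟨by simpa using hρ.ne', ?_⟩
    simp only [add_sub_cancel_left, Complex.norm_real, Real.norm_eq_abs]
    rw [abs_of_pos (by positivity)]
    linarith
  have hVopen : IsOpen {v : ℂ | v ≠ z ∧ ‖v - z‖ < ρ} :=
    isOpen_ne.inter (isOpen_lt (continuous_id.sub continuous_const).norm continuous_const)
  exact (hd1.analyticOnNhd hopen).eqOn_of_preconnected_of_eventuallyEq (hd2.analyticOnNhd hopen)
    hconn ((hSmem _).2 ⟨hv0.1, (h _ hv0.1 hv0.2).1⟩)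
    (by filter_upwards [hVopen.mem_nhds hv0] with v hv using (h v hv.1 hv.2).2)
    ((hSmem w).2 ⟨hzw.symm, hw⟩)

end OPEAlgebra.IsCorrelator

/-! ### The Ward identity -/

/-- A function holomorphic off a finite set with removable singularities extends to an entire
function. -/
theorem exists_differentiable_eqOn_compl {S : Set ℂ} (hS : S.Finite) {g : ℂ → ℂ}
    (hg : DifferentiableOn ℂ g Sᶜ)
    (h : ∀ s ∈ S, ∃ k : ℂ → ℂ, AnalyticAt ℂ k s ∧ ∀ᶠ u in 𝓝[≠] s, g u = k u) :
    ∃ F : ℂ → ℂ, Differentiable ℂ F ∧ EqOn F g Sᶜ := by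
  classical
  choose! k hk hgk using h
  refine ⟨fun u => if u ∈ S then k u u else g u, fun s => ?_, fun u hu => if_neg hu⟩
  by_cases hs : s ∈ S
  · refine (hk s hs).differentiableAt.congr_of_eventuallyEq ?_
    have hS' : (S \ {s})ᶜ ∈ 𝓝 s :=
      (hS.subset sdiff_subset).isClosed.isOpen_compl.mem_nhds fun h => h.2 rfl
    filter_upwards [hS', eventually_nhdsWithin_iff.1 (hgk s hs)] with u hu hu'
    rcases eq_or_ne u s with rfl | hus
    · exact if_pos hs
    · have : u ∉ S := fun h => hu ⟨h, hus⟩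
      rw [if_neg this]
      exact hu' hus
  · have hopen := hS.isClosed.isOpen_compl.mem_nhds hs
    refine (hg.differentiableAt hopen).congr_of_eventuallyEq ?_
    filter_upwards [hopen] with u hu using if_neg hu

namespace OPEAlgebra.IsCorrelator

variable {V : Type*} [AddCommGroup V] [Module ℂ V] {𝒜 : OPEAlgebra V} {corr : List (V × ℂ) → ℂ}
  (hcorr : 𝒜.IsCorrelator corr)
include hcorr

/-- Moving an operator past the first `i` operators of a sequence. -/
theorem corr_cons_insertions {n : ℕ} {p₀ : ZMod 2} {p : Fin n → ZMod 2} {T₀ : V} {T : Fin n → V}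
    (hT₀ : T₀ ∈ 𝒜.parity p₀) (hT : ∀ i, T i ∈ 𝒜.parity (p i)) {z : Fin n → ℂ}
    (hz : Function.Injective z) {u : ℂ} (hu : u ∉ range z) (i : ℕ) (hi : i ≤ n) :
    corr ((T₀, u) :: insertions T z) =
      (∏ j ∈ Finset.univ.filter (fun j : Fin n => (j : ℕ) < i), parSign p₀ (p j)) *
        corr ((insertions T z).take i ++ (T₀, u) :: (insertions T z).drop i) := by
  induction i with
  | zero => simp
  | succ i ih =>
    have hi' : i < (insertions T z).length := by simpa [insertions] using hi
    have hget : (insertions T z)[i] = (T ⟨i, hi⟩, z ⟨i, hi⟩) := by simp [insertions]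
    have hfilter : Finset.univ.filter (fun j : Fin n => (j : ℕ) < i + 1) =
        insert ⟨i, hi⟩ (Finset.univ.filter (fun j : Fin n => (j : ℕ) < i)) := by
      ext j
      simp only [Finset.mem_filter, Finset.mem_univ, true_and, Finset.mem_insert, Fin.ext_iff]
      omega
    have hsplit : insertions T z = (insertions T z).take i ++
        (T ⟨i, hi⟩, z ⟨i, hi⟩) :: (insertions T z).drop (i + 1) := by
      rw [← hget, ← List.drop_eq_getElem_cons hi', List.take_append_drop]
    have hpts : DistinctPoints ((insertions T z).take i ++ (T₀, u) :: (insertions T z).drop i) := by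
      rw [distinctPoints_append_cons, List.take_append_drop]
      refine ⟨distinctPoints_insertions.2 hz, fun P hP h => hu ?_⟩
      obtain ⟨j, rfl⟩ := List.mem_ofFn.1 hP
      exact ⟨j, h⟩
    rw [List.drop_eq_getElem_cons hi', hget] at hpts
    rw [ih (by omega), hfilter, Finset.prod_insert (by simp), List.drop_eq_getElem_cons hi', hget,
      hcorr.swap _ _ (hT _) hT₀ hpts, List.take_succ_eq_append_getElem hi', hget,
      List.append_assoc]
    have hcomm : parSign (p ⟨i, hi⟩) p₀ = parSign p₀ (p ⟨i, hi⟩) := by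
      simp only [parSign, mul_comm]
    rw [hcomm]
    simp only [List.cons_append, List.nil_append]
    ring

/-- The contraction is the principal part of the correlation function: near `z i` it differs from
it by a holomorphic function. -/
theorem exists_contraction_eq {n : ℕ} {p₀ : ZMod 2} {p : Fin n → ZMod 2} {T₀ : V} {T : Fin n → V}
    (hT₀ : T₀ ∈ 𝒜.parity p₀) (hT : ∀ i, T i ∈ 𝒜.parity (p i)) {z : Fin n → ℂ}
    (hz : Function.Injective z) (i : Fin n) :
    (∃ (N : ℕ) (a : ℕ → ℂ), ∀ u, 𝒜.contraction corr p₀ p T₀ T z i u =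
      ∑ k ∈ Finset.range N, a k * ((u - z i) ^ (k + 1))⁻¹) ∧
    ∃ h : ℂ → ℂ, AnalyticAt ℂ h (z i) ∧ ∀ᶠ u in 𝓝[≠] (z i),
      corr ((T₀, u) :: insertions T z) - 𝒜.contraction corr p₀ p T₀ T z i u = h u := by
  obtain ⟨N', hN'⟩ := 𝒜.bracket_eq_zero_of_large T₀ (T i)
  obtain ⟨N, hN⟩ : ∃ N : ℕ, ∀ m : ℤ, (N : ℤ) < m → 𝒜.bracket m T₀ (T i) = 0 :=
    ⟨N'.toNat, fun m hm => hN' m (by omega)⟩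
  set s := ∏ j ∈ Finset.univ.filter (fun j : Fin n => j < i), parSign p₀ (p j) with hs
  set X := (insertions T z).take i with hXdef
  set Y := (insertions T z).drop (i + 1) with hYdef
  set c : ℤ → ℂ := fun m => corr (X ++ (𝒜.bracket m T₀ (T i), z i) :: Y) with hc
  have hi' : (i : ℕ) < (insertions T z).length := by simp [insertions]
  have hget : (insertions T z)[(i : ℕ)] = (T i, z i) := by simp [insertions]
  have hL : insertions T z = X ++ (T i, z i) :: Y := by
    rw [← hget, ← List.drop_eq_getElem_cons hi', List.take_append_drop]
  have hdist : DistinctPoints (X ++ (T i, z i) :: Y) := hL ▸ distinctPoints_insertions.2 hz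
  obtain ⟨hXY, hzi⟩ := distinctPoints_append_cons.1 hdist
  have hc0 : ∀ m : ℤ, (N : ℤ) < m → c m = 0 := fun m hm => by
    simp only [hc, hN m hm]
    exact map_zero (hcorr.linearMap X Y (z i) hXY hzi)
  have hcontr : ∀ u, 𝒜.contraction corr p₀ p T₀ T z i u =
      s * ∑ k ∈ Finset.range N, c (k + 1) * ((u - z i) ^ (k + 1))⁻¹ := by
    intro u
    unfold OPEAlgebra.contraction
    rw [← hs, finsum_eq_sum_of_support_subset (s := Finset.range N)]
    · congr 1
      refine Finset.sum_congr rfl fun k _ => ?_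
      rw [insertions_update, mul_comm, zpow_neg]
      norm_cast
    · intro k hk
      by_contra hk'
      rw [Finset.mem_coe, Finset.mem_range, not_lt] at hk'
      refine hk ?_
      beta_reduce
      rw [insertions_update]
      change _ * c _ = 0
      rw [hc0 _ (by omega), mul_zero]
  refine ⟨⟨N, fun k => s * c (k + 1), fun u => ?_⟩, ?_⟩
  · rw [hcontr, Finset.mul_sum]
    exact Finset.sum_congr rfl fun k _ => by ring
  · obtain ⟨R, hR, hfar⟩ : ∃ R > 0, ∀ u, ‖u - z i‖ < R → ∀ P ∈ X ++ Y, ‖u - z i‖ < ‖P.2 - u‖ ∧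
        ‖u - z i‖ < ‖P.2 - z i‖ := by
      have hfin : {P : V × ℂ | P ∈ X ++ Y}.Finite := (X ++ Y).finite_toSet
      have : ∀ᶠ u in 𝓝 (z i), ∀ P ∈ {P : V × ℂ | P ∈ X ++ Y}, ‖u - z i‖ < ‖P.2 - u‖ ∧
          ‖u - z i‖ < ‖P.2 - z i‖ := by
        refine (eventually_all_finite hfin).2 fun P hP => ?_
        have h0 : 0 < ‖P.2 - z i‖ := norm_pos_iff.2 (sub_ne_zero.2 (hzi P hP))
        refine Eventually.and ?_ ?_
        · refine ContinuousAt.eventually_lt (by fun_prop) (by fun_prop) ?_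
          simpa using sub_ne_zero.2 (hzi P hP)
        · refine ContinuousAt.eventually_lt (by fun_prop) (by fun_prop) ?_
          simpa using sub_ne_zero.2 (hzi P hP)
      obtain ⟨R, hR, h⟩ := Metric.eventually_nhds_iff.1 this
      exact ⟨R, hR, fun u hu => h (by rwa [dist_eq_norm])⟩
    have key : ∀ u, u ≠ z i → ‖u - z i‖ < R → HasSum (fun j : ℕ => (u - z i) ^ j * (s * c (-j)))
        (corr ((T₀, u) :: insertions T z) - 𝒜.contraction corr p₀ p T₀ T z i u) := by
      intro u hu huR
      have hu0 : u - z i ≠ 0 := sub_ne_zero.2 hu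
      have hne : ∀ P ∈ X ++ Y, P.2 ≠ u := by
        intro P hP h
        have := (hfar u huR P hP).1
        rw [h, sub_self, norm_zero] at this
        linarith [norm_nonneg (u - z i)]
      have hur : u ∉ range z := by
        rintro ⟨j, hj⟩
        have hmem : (T j, z j) ∈ X ++ (T i, z i) :: Y := by
          rw [← hL]
          exact List.mem_ofFn.2 ⟨j, rfl⟩
        simp only [List.mem_append, List.mem_cons] at hmem
        rcases hmem with h | h | h
        · exact hne _ (List.mem_append.2 (Or.inl h)) hj
        · exact hu (hj ▸ (Prod.ext_iff.1 h).2)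
        · exact hne _ (List.mem_append.2 (Or.inr h)) hj
      have hmove := hcorr.corr_cons_insertions hT₀ hT hz hur i i.2.le
      rw [List.drop_eq_getElem_cons hi', hget] at hmove
      have hope := hcorr.ope X Y T₀ (T i) u (z i)
        (distinctPoints_append_cons_cons.2 ⟨hXY, hne, hzi, hu.symm⟩)
        fun P hP => (hfar u huR P hP).2
      have h1 := (hasSum_int_iff_of_eq_zero (N := N) (fun m hm => by
        change _ * c m = 0
        rw [hc0 m hm, mul_zero])).2 hope
      -- the first `N` terms of the OPE, those with `m > 0`, make up the contraction
      have h2 := ((hasSum_nat_add_iff' N).2 h1).mul_left s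
      have hval : s * (corr (X ++ (T₀, u) :: (T i, z i) :: Y) - ∑ j ∈ Finset.range N,
          (u - z i) ^ (-((N : ℤ) - j)) * c (N - j)) =
          corr ((T₀, u) :: insertions T z) - 𝒜.contraction corr p₀ p T₀ T z i u := by
        rw [hmove, hcontr, mul_sub, ← Finset.sum_range_reflect]
        congr 2
        refine Finset.sum_congr rfl fun k hk => ?_
        have hkN : k < N := Finset.mem_range.1 hk
        have hk1 : (N : ℤ) - ((N - 1 - k : ℕ) : ℤ) = ((k + 1 : ℕ) : ℤ) := by omega
        rw [hk1, zpow_neg, zpow_natCast, mul_comm]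
        push_cast
        rfl
      rw [← hval]
      refine h2.congr_fun fun j => ?_
      have hj : -((N : ℤ) - ((j + N : ℕ) : ℤ)) = (j : ℤ) := by omega
      have hj' : (N : ℤ) - ((j + N : ℕ) : ℤ) = -(j : ℤ) := by omega
      rw [hj', neg_neg, zpow_natCast]
      ring
    refine ⟨_, (hasFPowerSeriesOnBall_tsum (b := fun j : ℕ => s * c (-j)) hR (fun y hy0 hy => by
      simpa using (key (z i + y) (by simpa using hy0) (by simpa using hy)).summable)
        (z i)).analyticAt, ?_⟩
    filter_upwards [self_mem_nhdsWithin, mem_nhdsWithin_of_mem_nhds (Metric.ball_mem_nhds _ hR)]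
      with u hu huR
    rw [mem_ball_iff_norm] at huR
    exact (key u hu huR).tsum_eq.symm

end OPEAlgebra.IsCorrelator

theorem mainTheorem1 {V : Type*} [AddCommGroup V] [Module ℂ V] (𝒜 : OPEAlgebra V)
    (corr : List (V × ℂ) → ℂ) (hcorr : 𝒜.IsCorrelator corr)
    (n : ℕ) (p₀ : ZMod 2) (p : Fin n → ZMod 2) (T₀ : V) (T : Fin n → V)
    (hT₀ : T₀ ∈ 𝒜.parity p₀) (hT : ∀ i, T i ∈ 𝒜.parity (p i))
    (z : Fin n → ℂ) (hz : Function.Injective z)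
    (U : Set ℂ) (hU : IsOpen U) (ε : ℂ → ℂ) (hε : DifferentiableOn ℂ ε U)
    (C : ℝ → ℂ) (hC : EncirclesOnce U (Set.range z) (Set.range z) C)
    (K : Fin n → ℝ → ℂ) (hK : ∀ i, EncirclesOnce U (Set.range z) {z i} (K i)) :
    contourIntegral C (fun u => ε u * corr ((T₀, u) :: insertions T z)) =
      ∑ i : Fin n, contourIntegral (K i)
        (fun u => ε u * 𝒜.contraction corr p₀ p T₀ T z i u) := by
  set f : ℂ → ℂ := fun u => corr ((T₀, u) :: insertions T z) with hf
  set c : Fin n → ℂ → ℂ := fun i u => 𝒜.contraction corr p₀ p T₀ T z i u with hc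
  have hcf : ∀ i, ∃ (N : ℕ) (a : ℕ → ℂ), ∀ u, c i u =
      ∑ k ∈ Finset.range N, a k * ((u - z i) ^ (k + 1))⁻¹ :=
    fun i => (hcorr.exists_contraction_eq hT₀ hT hz i).1
  have hCim : C '' Icc 0 1 ⊆ (range z)ᶜ := by
    rintro _ ⟨t, ht, rfl⟩
    exact hC.avoids t ht
  have hCU : C '' Icc 0 1 ⊆ U := by
    rintro _ ⟨t, ht, rfl⟩
    exact hC.mapsTo t ht
  -- `C` winds around `z i`, but around no point outside of `U`
  have hzU : ∀ i, z i ∈ U := fun i => by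
    by_contra h
    exact zero_ne_one ((hC.winding_outside _ h).symm.trans (hC.winding_inside _ ⟨i, rfl⟩))
  have hcan : ∀ i u, u ≠ z i → DifferentiableAt ℂ (c i) u := by
    intro i u hu
    obtain ⟨N, a, ha⟩ := hcf i
    rw [show c i = _ from funext ha]
    have : u - z i ≠ 0 := sub_ne_zero.2 hu
    refine DifferentiableAt.fun_sum fun k _ => ?_
    fun_prop (disch := exact pow_ne_zero _ this)
  have hfd : DifferentiableOn ℂ f (range z)ᶜ := by
    refine (hcorr.differentiableOn [] (insertions T z)
      (distinctPoints_insertions.2 hz) T₀).mono fun u hu P hP h => hu ?_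
    obtain ⟨j, rfl⟩ := List.mem_ofFn.1 hP
    exact ⟨j, h⟩
  have hgd : DifferentiableOn ℂ (fun u => f u - ∑ i, c i u) (range z)ᶜ := by
    refine hfd.sub fun u hu => DifferentiableAt.differentiableWithinAt ?_
    exact DifferentiableAt.fun_sum fun i _ => hcan i u fun h => hu ⟨i, h.symm⟩
  have hgr : ∀ s ∈ range z, ∃ k : ℂ → ℂ, AnalyticAt ℂ k s ∧
      ∀ᶠ u in 𝓝[≠] s, f u - ∑ i, c i u = k u := by
    rintro _ ⟨i, rfl⟩
    obtain ⟨h, hh, hev⟩ := (hcorr.exists_contraction_eq hT₀ hT hz i).2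
    have hother : AnalyticAt ℂ (fun u => ∑ j ∈ Finset.univ.erase i, c j u) (z i) := by
      refine Finset.analyticAt_fun_sum _ fun j hj => ?_
      have hne : z i ≠ z j := fun h => (Finset.ne_of_mem_erase hj) (hz h).symm
      refine Complex.analyticAt_iff_eventually_differentiableAt.2 ?_
      filter_upwards [eventually_ne_nhds hne] with u hu using hcan j u hu
    refine ⟨fun u => h u - ∑ j ∈ Finset.univ.erase i, c j u, hh.sub hother, ?_⟩
    filter_upwards [hev] with u hu
    rw [← hu, ← Finset.add_sum_erase _ _ (Finset.mem_univ i)]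
    ring
  obtain ⟨F, hF, hFeq⟩ := exists_differentiable_eqOn_compl (finite_range z) hgd hgr
  have hcc : ∀ i, ContinuousOn (fun u => ε u * c i u) (C '' Icc 0 1) := fun i =>
    (hε.continuousOn.mono hCU).mul fun u hu =>
      (hcan i u fun h => hCim hu ⟨i, h.symm⟩).continuousAt.continuousWithinAt
  have hεF : DifferentiableOn ℂ (fun u => ε u * F u) U := hε.mul hF.differentiableOn
  have hsplit : contourIntegral C (fun u => ε u * f u) =
      contourIntegral C (fun u => ε u * F u + ∑ i, ε u * c i u) := by
    refine contourIntegral_congr fun u hu => ?_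
    simp only [hFeq (hCim hu), ← Finset.mul_sum]
    ring
  rw [hsplit, contourIntegral_add hC.isLoop (hεF.continuousOn.mono hCU)
    (continuousOn_finsetSum _ fun i _ => hcc i),
    contourIntegral_eq_zero_of_differentiableOn hC.isLoop hU hCU hC.winding_outside hεF, zero_add,
    contourIntegral_sum hC.isLoop _ fun i _ => hcc i]
  refine Finset.sum_congr rfl fun i _ => ?_
  -- both loops wind once around `z i`, the only singularity of the contraction
  obtain ⟨N, a, ha⟩ := hcf i
  choose e he using fun k : ℕ => exists_contourIntegral_mul_inv_pow hU (hzU i) (k + 1) hε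
  have hint : ∀ γ : ℝ → ℂ, IsPiecewiseC1Loop γ → γ '' Icc 0 1 ⊆ U →
      (∀ b ∉ U, windingNumber γ b = 0) → z i ∉ γ '' Icc 0 1 → windingNumber γ (z i) = 1 →
      contourIntegral γ (fun u => ε u * c i u) = ∑ k ∈ Finset.range N, a k * e k := by
    intro γ hγ hγU hw0 hzγ hw1
    have h1 : (fun u => ε u * c i u) = fun u => ∑ k ∈ Finset.range N,
        a k * (ε u * ((u - z i) ^ (k + 1))⁻¹) := by
      funext u
      rw [ha, Finset.mul_sum]
      exact Finset.sum_congr rfl fun k _ => by ring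
    rw [h1, contourIntegral_sum hγ]
    · refine Finset.sum_congr rfl fun k _ => ?_
      rw [contourIntegral_const_mul, he k γ hγ hγU hw0 hzγ, hw1, mul_one]
    · intro k _
      simp only [← inv_pow]
      exact continuousOn_const.mul ((hε.continuousOn.mono hγU).mul
        ((continuousOn_inv_sub hzγ).pow _))
  rw [hint C hC.isLoop hCU hC.winding_outside (fun h => hCim h ⟨i, rfl⟩)
    (hC.winding_inside _ ⟨i, rfl⟩)]
  refine (hint (K i) (hK i).isLoop ?_ (hK i).winding_outside ?_
    ((hK i).winding_inside _ rfl)).symm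
  · rintro _ ⟨t, ht, rfl⟩
    exact (hK i).mapsTo t ht
  · rintro ⟨t, ht, h⟩
    exact (hK i).avoids t ht ⟨i, h.symm⟩
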